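/- Let $A$ be a finite alphabet, $A^+$ the set of non-empty words over $A$, and let $\sigma : A\to A^+$ be a substitution, extended by concatenation to words and to two-sided sequences (for $y\in A^{\mathbb Z}$ the word $\sigma(y[0])$ starts in $\sigma(y)$ at position $0$); $\sigma^0$ is the identity and $|w|$ denotes the length of a word $w$. Let $L(\sigma)$ be the set of all factors of the words $\sigma^n(a)$, $a\in A$, $n\ge 1$, let $X_\sigma=\{x\in A^{\mathbb Z} : x[-n,n]\in L(\sigma)\text{ for all } n\ge 0\}$, with the subspace topology of the product of the discrete spaces $A$, and let $T$ be the shift, $(Tx)[k]=x[k+1]$. Put $[a]=\{x\in X_\sigma : x[0]=a\}$ for $a\in A$ (this set may be empty). Assume that $\sigma$ is aperiodic, i.e. that $X_\sigma$ contains no periodic point of $T$. Then for every $n\ge 0$ the family $$\mathcal P_n=\{T^i\sigma^n([a]) : a\in A,\ 0\le i<|\sigma^n(a)|\}$$ is a partition of $X_\sigma$ into clopen sets: its members are clopen subsets of $X_\sigma$, members with distinct indices $(a,i)$ are disjoint, and their union is $X_\sigma$ (members with $[a]=\emptyset$ are empty). Moreover, the sequence $(\mathcal P_n)_{n\ge 0}$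 is nested: for every $n\ge 0$, each member of $\mathcal P_{n+1}$ is contained in a member of $\mathcal P_n$, and the bases $B(\mathcal P_n)=\bigcup_{a\in A}\sigma^n([a])$ satisfy $B(\mathcal P_{n+1})\subseteq B(\mathcal P_n)$. -/

import Mathlib

/-- A substitution on the alphabet `A`: a map from letters to non-empty words over `A`. -/
structure Substitution (A : Type*) where
  img : A → List A
  img_ne_nil : ∀ a, img a ≠ []

namespace Substitution

variable {A : Type*} (σ : Substitution A)

/-- The extension of `σ` to words by concatenation. -/
def onWord (w : List A) : List A := w.flatMap σ.img

/-- The word `σⁿ(a)`; in particular `σ⁰(a) = a`. -/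
def powImg (n : ℕ) (a : A) : List A := σ.onWord^[n] [a]

/-- The language `L(σ)`: all factors of the words `σⁿ(a)`, `a ∈ A`, `n ≥ 1`. -/
def language : Set (List A) := {w | ∃ (a : A) (n : ℕ), 1 ≤ n ∧ w <:+: σ.powImg n a}

/-- The word `x[-n, n]` of a two-sided sequence. -/
def centralWord (x : ℤ → A) (n : ℕ) : List A :=
  List.ofFn fun i : Fin (2 * n + 1) => x (-(n : ℤ) + (i : ℕ))

/-- The space `X_σ` of all two-sided sequences whose central words lie in the language. -/
def space : Set (ℤ → A) := {x | ∀ n : ℕ, centralWord x n ∈ σ.language}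

/-- The shift on two-sided sequences. -/
def shift (x : ℤ → A) : ℤ → A := fun k => x (k + 1)

/-- `σ` is aperiodic if `X_σ` contains no periodic point of the shift. -/
def Aperiodic : Prop := ∀ x ∈ σ.space, x ∉ Function.periodicPts (shift (A := A))

/-- The position at which the block `σ(y[k])` starts in `σ(y)`; the block `σ(y[0])` starts
at position `0`. -/
noncomputable def cut (y : ℤ → A) (k : ℤ) : ℤ :=
  ∑ i ∈ Finset.Ico 0 k, ((σ.img (y i)).length : ℤ)
    - ∑ i ∈ Finset.Ico k 0, ((σ.img (y i)).length : ℤ)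

theorem cut_zero (y : ℤ → A) : σ.cut y 0 = 0 := by simp [cut]

theorem cut_succ (y : ℤ → A) (k : ℤ) :
    σ.cut y (k + 1) = σ.cut y k + (σ.img (y k)).length := by
  unfold cut
  rcases le_or_gt 0 k with hk | hk
  · have h1 : Finset.Ico 0 (k + 1) = insert k (Finset.Ico 0 k) := by
      ext i; simp only [Finset.mem_Ico, Finset.mem_insert]; omega
    have h2 : Finset.Ico (k + 1) 0 = ∅ := Finset.Ico_eq_empty (by omega)
    have h3 : Finset.Ico k 0 = ∅ := Finset.Ico_eq_empty (by omega)
    rw [h1, h2, h3, Finset.sum_insert (by simp)]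
    simp only [Finset.sum_empty]; ring
  · have h1 : Finset.Ico k 0 = insert k (Finset.Ico (k + 1) 0) := by
      ext i; simp only [Finset.mem_Ico, Finset.mem_insert]; omega
    have h2 : Finset.Ico 0 (k + 1) = ∅ := Finset.Ico_eq_empty (by omega)
    have h3 : Finset.Ico 0 k = ∅ := Finset.Ico_eq_empty (by omega)
    rw [h1, h2, h3, Finset.sum_insert (by simp)]
    simp only [Finset.sum_empty]; ring

theorem cut_strictMono (y : ℤ → A) : StrictMono (σ.cut y) :=
  strictMono_int_of_lt_succ fun k => by
    have := List.length_pos_iff.mpr (σ.img_ne_nil (y k))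
    rw [cut_succ]; omega

theorem exists_block (y : ℤ → A) (m : ℤ) :
    ∃ k : ℤ, σ.cut y k ≤ m ∧ m < σ.cut y (k + 1) := by
  induction m using Int.induction_on with
  | zero =>
    refine ⟨0, (σ.cut_zero y).le, ?_⟩
    have := σ.cut_strictMono y (show (0 : ℤ) < 0 + 1 by norm_num)
    rwa [cut_zero] at this
  | succ m ih =>
    obtain ⟨k, h1, h2⟩ := ih
    rcases lt_or_ge ((m : ℤ) + 1) (σ.cut y (k + 1)) with h | h
    · exact ⟨k, by omega, h⟩
    · have := σ.cut_strictMono y (lt_add_one (k + 1))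
      exact ⟨k + 1, h, by omega⟩
  | pred m ih =>
    obtain ⟨k, h1, h2⟩ := ih
    rcases le_or_gt (σ.cut y k) (-(m : ℤ) - 1) with h | h
    · exact ⟨k, h, by omega⟩
    · have := σ.cut_strictMono y (sub_one_lt k)
      exact ⟨k - 1, by omega, by rwa [sub_add_cancel]⟩

/-- The index `k` of the block `σ(y[k])` of `σ(y)` that covers position `m`. -/
noncomputable def block (y : ℤ → A) (m : ℤ) : ℤ := (σ.exists_block y m).choose

theorem block_spec (y : ℤ → A) (m : ℤ) :
    σ.cut y (σ.block y m) ≤ m ∧ m < σ.cut y (σ.block y m + 1) :=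
  (σ.exists_block y m).choose_spec

theorem block_lt (y : ℤ → A) (m : ℤ) :
    (m - σ.cut y (σ.block y m)).toNat < (σ.img (y (σ.block y m))).length := by
  have h := σ.block_spec y m
  rw [cut_succ] at h
  omega

/-- The action of `σ` on two-sided sequences:
`σ(y) = … σ(y[-2]) σ(y[-1]) . σ(y[0]) σ(y[1]) …`, with `σ(y[0])` starting at position `0`. -/
noncomputable def onSeq (y : ℤ → A) : ℤ → A := fun m =>
  (σ.img (y (σ.block y m)))[(m - σ.cut y (σ.block y m)).toNat]'(σ.block_lt y m)

/-- In `σ(y)`, the word `σ(y[k])` is read from position `cut k` on. -/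
theorem onSeq_cut_add (y : ℤ → A) (k : ℤ) (j : ℕ) (hj : j < (σ.img (y k)).length) :
    σ.onSeq y (σ.cut y k + j) = (σ.img (y k))[j] := by
  have hb : σ.block y (σ.cut y k + j) = k := by
    obtain ⟨h1, h2⟩ := σ.block_spec y (σ.cut y k + j)
    have h3 := (σ.cut_strictMono y).lt_iff_lt.mp
      (h1.trans_lt (by rw [cut_succ]; omega : σ.cut y k + j < σ.cut y (k + 1)))
    have h4 := (σ.cut_strictMono y).lt_iff_lt.mp
      (lt_of_le_of_lt (by omega : σ.cut y k ≤ σ.cut y k + j) h2)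
    omega
  unfold onSeq
  simp [hb]

/-- The set `[a]` of all `x ∈ X_σ` with `x[0] = a`. -/
def cylinder (a : A) : Set (ℤ → A) := {x ∈ σ.space | x 0 = a}

end Substitution

/-- The level `TⁱA(v)` of the tower with base `A(v)`. -/
def towerLevel {E V : Type*} (T : E → E) (base : V → Set E) (v : V) (i : ℕ) : Set E :=
  T^[i] '' base v

/-- The family `{TⁱA(v) : v ∈ V, 0 ≤ i < h(v)}` is a Kakutani–Rokhlin partition of the subspace
`X`: `V` is finite, and the levels are clopen in the subspace topology of `X`, pairwise disjoint
(for distinct indices), and have union `X`. Empty levels are allowed. -/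
structure IsKRPartition {E V : Type*} [TopologicalSpace E] (X : Set E) (T : E → E)
    (base : V → Set E) (height : V → ℕ) : Prop where
  finite_index : Finite V
  height_pos : ∀ v, 0 < height v
  subset : ∀ v, ∀ i < height v, towerLevel T base v i ⊆ X
  clopen : ∀ v, ∀ i < height v, IsClopen ((↑) ⁻¹' towerLevel T base v i : Set X)
  disjoint : ∀ v, ∀ i < height v, ∀ w, ∀ j < height w, (v, i) ≠ (w, j) →
    Disjoint (towerLevel T base v i) (towerLevel T base w j)
  cover : X ⊆ ⋃ v, ⋃ i, ⋃ (_ : i < height v), towerLevel T base v i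

/-- The family of levels `(base', height')` refines the family `(base, height)` and its base
`⋃ A'(v)` is contained in the base `⋃ A(v)`. -/
structure IsKRNested {E V V' : Type*} (T : E → E) (base' : V' → Set E) (height' : V' → ℕ)
    (base : V → Set E) (height : V → ℕ) : Prop where
  refines : ∀ v', ∀ i' < height' v', ∃ v, ∃ i < height v,
    towerLevel T base' v' i' ⊆ towerLevel T base v i
  base_subset : (⋃ v', base' v') ⊆ ⋃ v, base v

-- The covering property is desubstitution: long central words of a point of `X_σ` lie in words
-- `σ(σ^m(a))`, and a compactness argument turns the resulting approximate preimages into a true one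
-- (`exists_preimage`). Disjointness is recognizability: two representations of `x` by `σ^n`-images
-- of points of `X_σ` differ only by a reindexing (`IsSubstitutive.exists_eq_reindex`). Finitely
-- many compact levels that partition `X_σ` are then clopen, and nestedness comes from cutting
-- `σ^(n+1)(a) = σ^n(σ(a))` into the blocks `σ^n(b)`.
--
-- Recognizability is first proved for elementary morphisms, those that do not factor through a
-- smaller alphabet, at every aperiodic sequence. If two representations share a cut but then
-- disagree, two images are prefix-comparable; factoring out the shorter one repeatedly ends in a
-- smaller alphabet (`exists_right_reduction`), so an elementary morphism has only one
-- representation with a given cut. If they share no cut, a minimality argument makes first and last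
-- letters of images determine the letter (`Elementary.getLast?_injective`); the pair of
-- representations then evolves deterministically among finitely many states, which forces
-- periodicity.
--
-- A general morphism that is not elementary is `α ∘ β` through a smaller alphabet. Induction on the
-- alphabet size applies to the conjugate `β ∘ α`, acting on the `β`-images of the original space
-- (`IsSubstitutive.conjugate`), and recognizability is carried back to `α ∘ β`.

universe u

/-! ### Words read in two-sided sequences, and representations with cuts -/

/-- A map from letters to words is non-erasing if no letter is sent to the empty word. -/
def NonErasing {A B : Type*} (σ : A → List B) : Prop := ∀ a, σ a ≠ []

/-- The word `w` is read in the two-sided sequence `x` from position `p` on. -/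
def Reads {B : Type*} (x : ℤ → B) (p : ℤ) (w : List B) : Prop :=
  ∀ (j : ℕ) (b : B), w[j]? = some b → x (p + j) = b

/-- The two-sided sequence `x` is the concatenation of the words `σ (y k)`, and `σ (y k)` starts
at position `c k`. -/
structure IsRep {A B : Type*} (σ : A → List B) (x : ℤ → B) (y : ℤ → A) (c : ℤ → ℤ) : Prop where
  step : ∀ k, c (k + 1) = c k + (σ (y k)).length
  reads : ∀ k, Reads x (c k) (σ (y k))

/-- The composition of two morphisms of free monoids, given on letters. -/
def compMor {A B C : Type*} (α : B → List C) (β : A → List B) (a : A) : List C :=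
  (β a).flatMap α

/-- A two-sided sequence that is not periodic. -/
def AperiodicSeq {B : Type*} (x : ℤ → B) : Prop := ∀ p : ℤ, 0 < p → ¬ ∀ k, x (k + p) = x k

section Reads

variable {B : Type*} {x : ℤ → B} {p : ℤ}

theorem reads_nil : Reads x p [] := fun j b h => by simp at h

theorem reads_append {u v : List B} :
    Reads x p (u ++ v) ↔ Reads x p u ∧ Reads x (p + u.length) v := by
  constructor
  · intro h
    refine ⟨fun j b hj => h j b ?_, fun j b hj => ?_⟩
    · have := (List.getElem?_eq_some_iff.mp hj).1
      rw [List.getElem?_append_left this, hj]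
    · have := h (u.length + j) b (by rw [List.getElem?_append_right (by omega)]; simpa using hj)
      rw [← this]; push_cast; congr 1; ring
  · rintro ⟨h1, h2⟩ j b hj
    rcases lt_or_ge j u.length with h | h
    · rw [List.getElem?_append_left h] at hj
      exact h1 j b hj
    · rw [List.getElem?_append_right h] at hj
      rw [← h2 _ b hj]; congr 1; omega

theorem reads_singleton {b : B} : Reads x p [b] ↔ x p = b := by
  constructor
  · intro h; simpa using h 0 b (by simp)
  · intro h j b' hj
    have := (List.getElem?_eq_some_iff.mp hj).1
    obtain rfl : j = 0 := by simpa using this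
    simp at hj; simp [h, hj]

theorem reads_cons {b : B} {w : List B} :
    Reads x p (b :: w) ↔ x p = b ∧ Reads x (p + 1) w := by
  rw [← List.singleton_append, reads_append, reads_singleton]; simp

theorem Reads.prefix {u v : List B} (hu : Reads x p u) (hv : Reads x p v)
    (h : u.length ≤ v.length) : u <+: v := by
  rw [List.prefix_iff_getElem?]
  intro i hi
  have h1 := hu i _ (List.getElem?_eq_getElem hi)
  have h2 := hv i _ (List.getElem?_eq_getElem (hi.trans_le h))
  rw [List.getElem?_eq_getElem (hi.trans_le h), ← h1, ← h2]

theorem Reads.eq {u v : List B} (hu : Reads x p u) (hv : Reads x p v)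
    (h : u.length = v.length) : u = v :=
  (hu.prefix hv h.le).eq_of_length h

theorem reads_translate {w : List B} (q : ℤ) :
    Reads (fun k => x (k + q)) (p - q) w ↔ Reads x p w := by
  unfold Reads
  refine forall_congr' fun j => forall_congr' fun b => ?_
  dsimp only
  rw [show p - q + j + q = p + j by ring]

theorem reads_reverse {w : List B} :
    Reads (fun k => x (-1 - k)) (-(p + w.length)) w.reverse ↔ Reads x p w := by
  constructor
  · intro h j b hj
    have hl := (List.getElem?_eq_some_iff.mp hj).1
    have := h (w.length - 1 - j) b (by
      rw [List.getElem?_reverse (by omega), ← hj]; congr 1; omega)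
    rw [← this]; congr 1; omega
  · intro h j b hj
    have hl := (List.getElem?_eq_some_iff.mp hj).1
    rw [List.length_reverse] at hl
    rw [List.getElem?_reverse hl] at hj
    rw [← h _ b hj]; dsimp only; congr 1; omega

end Reads

theorem eq_of_step {f g : ℤ → ℤ} (k₀ : ℤ) (h : ∀ k, f (k + 1) - f k = g (k + 1) - g k)
    (h0 : f k₀ = g k₀) (k : ℤ) : f k = g k := by
  refine Int.inductionOn' (motive := fun k => f k = g k) k k₀ h0 (fun k _ ih => ?_)
    fun k _ ih => ?_
  · have := h k; omega
  · have := h (k - 1); rw [sub_add_cancel] at this; omega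

theorem exists_partial_sum (f : ℤ → ℤ) (p : ℤ) :
    ∃ c : ℤ → ℤ, c 0 = p ∧ ∀ k, c (k + 1) = c k + f k := by
  refine ⟨fun k => p + (∑ i ∈ Finset.Ico 0 k, f i - ∑ i ∈ Finset.Ico k 0, f i), by simp,
    fun k => ?_⟩
  rcases le_or_gt 0 k with hk | hk
  · have h1 : Finset.Ico 0 (k + 1) = insert k (Finset.Ico 0 k) := by
      ext i; simp only [Finset.mem_Ico, Finset.mem_insert]; omega
    have h2 : Finset.Ico (k + 1) 0 = ∅ := Finset.Ico_eq_empty (by omega)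
    have h3 : Finset.Ico k 0 = ∅ := Finset.Ico_eq_empty (by omega)
    dsimp only
    rw [h1, h2, h3, Finset.sum_insert (by simp)]
    simp only [Finset.sum_empty]; ring
  · have h1 : Finset.Ico k 0 = insert k (Finset.Ico (k + 1) 0) := by
      ext i; simp only [Finset.mem_Ico, Finset.mem_insert]; omega
    have h2 : Finset.Ico 0 (k + 1) = ∅ := Finset.Ico_eq_empty (by omega)
    have h3 : Finset.Ico 0 k = ∅ := Finset.Ico_eq_empty (by omega)
    dsimp only
    rw [h1, h2, h3, Finset.sum_insert (by simp)]
    simp only [Finset.sum_empty]; ring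

theorem StrictMono.exists_int_block {c : ℤ → ℤ} (hc : StrictMono c) (m : ℤ) :
    ∃ k : ℤ, c k ≤ m ∧ m < c (k + 1) := by
  refine Int.inductionOn' (motive := fun m => ∃ k : ℤ, c k ≤ m ∧ m < c (k + 1)) m (c 0)
    ⟨0, le_rfl, hc (by norm_num)⟩ (fun m _ ih => ?_) fun m _ ih => ?_
  · obtain ⟨k, h1, h2⟩ := ih
    rcases lt_or_ge (m + 1) (c (k + 1)) with h | h
    · exact ⟨k, by omega, h⟩
    · have := hc (lt_add_one (k + 1))
      exact ⟨k + 1, h, by omega⟩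
  · obtain ⟨k, h1, h2⟩ := ih
    rcases le_or_gt (c k) (m - 1) with h | h
    · exact ⟨k, h, by omega⟩
    · have := hc (sub_one_lt k)
      exact ⟨k - 1, by omega, by rw [sub_add_cancel]; omega⟩

theorem StrictMono.int_block_unique {c : ℤ → ℤ} (hc : StrictMono c) {m k l : ℤ}
    (hk : c k ≤ m) (hk' : m < c (k + 1)) (hl : c l ≤ m) (hl' : m < c (l + 1)) : k = l := by
  have h1 := hc.lt_iff_lt.mp (hk.trans_lt hl')
  have h2 := hc.lt_iff_lt.mp (hl.trans_lt hk')
  omega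

namespace IsRep

variable {A B C : Type*} {σ : A → List B} {x x' : ℤ → B} {y z : ℤ → A} {c d : ℤ → ℤ}

theorem strictMono (hσ : NonErasing σ) (h : IsRep σ x y c) : StrictMono c :=
  strictMono_int_of_lt_succ fun k => by
    have := List.length_pos_iff.mpr (hσ (y k))
    rw [h.step]; omega

theorem cut_eq (h : IsRep σ x y c) (h' : IsRep σ x' y d) (k₀ : ℤ) (h0 : c k₀ = d k₀) : c = d :=
  funext <| eq_of_step k₀ (fun k => by rw [h.step, h'.step]; ring) h0

theorem exists_offset (h : IsRep σ x y c) (hσ : NonErasing σ) (m : ℤ) :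
    ∃ (k : ℤ) (j : ℕ), j < (σ (y k)).length ∧ m = c k + j := by
  obtain ⟨k, h1, h2⟩ := (h.strictMono hσ).exists_int_block m
  rw [h.step] at h2
  exact ⟨k, (m - c k).toNat, by omega, by omega⟩

theorem seq_eq (hσ : NonErasing σ) (h : IsRep σ x y c) (h' : IsRep σ x' y c) : x = x' := by
  funext m
  obtain ⟨k, j, hj, rfl⟩ := h.exists_offset hσ m
  rw [h.reads k j _ (List.getElem?_eq_getElem hj), h'.reads k j _ (List.getElem?_eq_getElem hj)]

theorem reindex (h : IsRep σ x y c) (m : ℤ) :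
    IsRep σ x (fun k => y (k + m)) (fun k => c (k + m)) where
  step k := by rw [show k + 1 + m = k + m + 1 by ring, h.step]
  reads k := h.reads _

theorem translate (h : IsRep σ x y c) (q : ℤ) :
    IsRep σ (fun k => x (k + q)) y (fun k => c k - q) where
  step k := by rw [h.step]; ring
  reads k := (reads_translate q).2 (h.reads k)

theorem reverse (h : IsRep σ x y c) :
    IsRep (fun a => (σ a).reverse) (fun k => x (-1 - k)) (fun k => y (-1 - k))
      (fun k => - c (-k)) where
  step k := by
    have := h.step (-1 - k)
    rw [show -1 - k + 1 = -k by ring] at this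
    rw [show -(k + 1) = -1 - k by ring, List.length_reverse]; omega
  reads k := by
    have := h.step (-1 - k)
    rw [show -1 - k + 1 = -k by ring] at this
    rw [this]
    exact reads_reverse.2 (h.reads _)

theorem reads_flatMap (h : IsRep σ x y c) {w : List A} {p : ℤ} (hw : Reads y p w) :
    c (p + w.length) = c p + (w.flatMap σ).length ∧ Reads x (c p) (w.flatMap σ) := by
  induction w generalizing p with
  | nil => simp [reads_nil]
  | cons a w ih =>
    rw [reads_cons] at hw
    obtain ⟨ha, hw⟩ := hw
    obtain ⟨h1, h2⟩ := ih hw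
    subst ha
    rw [h.step] at h1 h2
    rw [List.flatMap_cons, reads_append, List.length_append, List.length_cons]
    refine ⟨?_, h.reads p, h2⟩
    push_cast at *
    rw [← add_assoc (c p), ← h1]; congr 1; ring

theorem comp {α : B → List C} {u : ℤ → B} {x : ℤ → C} {c d : ℤ → ℤ} {β : A → List B}
    (hβ : IsRep β u y d) (hα : IsRep α x u c) : IsRep (compMor α β) x y (fun k => c (d k)) where
  step k := by rw [hβ.step, (hα.reads_flatMap (hβ.reads k)).1]; rfl
  reads k := (hα.reads_flatMap (hβ.reads k)).2

end IsRep

theorem exists_isRep {A B : Type*} {σ : A → List B} (hσ : NonErasing σ) (y : ℤ → A) (k₀ p : ℤ) :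
    ∃ x c, IsRep σ x y c ∧ c k₀ = p := by
  suffices H : ∀ y : ℤ → A, ∃ x c, IsRep σ x y c ∧ c 0 = p by
    obtain ⟨x, c, h, h0⟩ := H fun k => y (k + k₀)
    refine ⟨x, fun k => c (k + -k₀), ?_, by simpa using h0⟩
    simpa using h.reindex (-k₀)
  intro y
  obtain ⟨c, h0, hc⟩ := exists_partial_sum (fun k => ((σ (y k)).length : ℤ)) p
  have hm : StrictMono c := strictMono_int_of_lt_succ fun k => by
    have := List.length_pos_iff.mpr (hσ (y k))
    rw [hc]; omega
  choose b hb hb' using hm.exists_int_block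
  have hlt : ∀ m, (m - c (b m)).toNat < (σ (y (b m))).length := fun m => by
    have h1 := hb m
    have h2 := hb' m
    rw [hc] at h2; omega
  refine ⟨fun m => (σ (y (b m)))[(m - c (b m)).toNat]'(hlt m), c, ⟨hc, ?_⟩, h0⟩
  intro k j a hj
  have hl := (List.getElem?_eq_some_iff.mp hj).1
  have hbk : b (c k + j) = k :=
    hm.int_block_unique (hb _) (hb' _) (by omega) (by rw [hc]; omega)
  have := (List.getElem?_eq_some_iff.mp hj).2
  simp [hbk, this]

namespace IsRep

variable {A B C : Type*} {σ : A → List B} {x x' : ℤ → B} {y z : ℤ → A} {c d : ℤ → ℤ}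

/-- The `α`-image of `u`, placed so as to share one cut with `x`, is also represented by `y` under
the composition, with the same cuts; hence it is `x`. -/
theorem decomp {α : B → List C} {u : ℤ → B} {x : ℤ → C} {e d : ℤ → ℤ} {β : A → List B}
    (hα : NonErasing α) (hβα : NonErasing (compMor α β))
    (h : IsRep (compMor α β) x y e) (hβ : IsRep β u y d) :
    ∃ c, IsRep α x u c ∧ ∀ k, c (d k) = e k := by
  obtain ⟨x', c, hc, h0⟩ := exists_isRep hα u (d 0) (e 0)
  have h1 := hβ.comp hc
  have h2 := h1.cut_eq h 0 h0
  rw [h2] at h1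
  obtain rfl := h1.seq_eq hβα h
  exact ⟨c, hc, congrFun h2⟩

/-- Translating `x` by the length of the image of one period gives a representation by the same `y`
with the same cuts. -/
theorem periodic (hσ : NonErasing σ) (h : IsRep σ x y c) {p : ℤ} (hp : 0 < p)
    (hy : ∀ k, y (k + p) = y k) : ∃ q, 0 < q ∧ ∀ k, x (k + q) = x k := by
  refine ⟨c p - c 0, sub_pos.2 (h.strictMono hσ hp), ?_⟩
  have h1 := (h.translate (c p - c 0))
  have h2 := h.reindex p
  simp only [hy] at h2
  have h3 := h2.translate (c p - c 0)
  have h4 := h3.cut_eq h 0 (by simp)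
  rw [h4] at h3
  exact congrFun (h3.seq_eq hσ h)

theorem aperiodic (hσ : NonErasing σ) (h : IsRep σ x y c) (hx : AperiodicSeq x) :
    AperiodicSeq y := fun p hp hy => by
  obtain ⟨q, hq, hxq⟩ := h.periodic hσ hp hy
  exact hx q hq hxq

end IsRep

theorem NonErasing.comp {A B C : Type*} {α : B → List C} {β : A → List B} (hα : NonErasing α)
    (hβ : NonErasing β) : NonErasing (compMor α β) := fun a h => by
  obtain ⟨b, w, hb⟩ := List.exists_cons_of_ne_nil (hβ a)
  simp [compMor, hb] at h
  exact hα b h.1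

theorem compMor_assoc {A B C D : Type*} (α : C → List D) (β : B → List C) (γ : A → List B) :
    compMor (compMor α β) γ = compMor α (compMor β γ) := by
  funext a
  simp [compMor, List.flatMap_assoc]; rfl

theorem length_le_compMor {A B C : Type*} {α : B → List C} (hα : NonErasing α) (β : A → List B)
    (a : A) : (β a).length ≤ (compMor α β a).length := by
  unfold compMor
  induction β a with
  | nil => simp
  | cons b w ih =>
    have := List.length_pos_iff.mpr (hα b)
    simp only [List.flatMap_cons, List.length_cons, List.length_append]; omega

/-! ### Reduction of the alphabet from two representations with a common cut -/

section Reduction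

variable {A B : Type u}

/-- The total length of the images of the letters. -/
def totalLength [Fintype A] (σ : A → List B) : ℕ := ∑ a, (σ a).length

theorem IsRep.of_singletons {C : Type*} {f : A → C} {u : ℤ → C} {y : ℤ → A} {e : ℤ → ℤ}
    (h : IsRep (fun a => [f a]) u y e) (h0 : e 0 = 0) (k : ℤ) : u k = f (y k) := by
  have he : ∀ k, e k = k := eq_of_step 0 (fun k => by rw [h.step]; simp) h0
  have := reads_singleton.1 (h.reads k)
  rwa [he] at this

/-- Identification of two letters with the same image. -/
theorem exists_factor_of_eq [Fintype A] {σ : A → List B} (hσ : NonErasing σ) {a b : A}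
    (hab : a ≠ b) (h : σ a = σ b) :
    ∃ (C : Type u) (_ : Fintype C) (f : A → C) (ρ : C → List B), NonErasing ρ ∧
      compMor ρ (fun a => [f a]) = σ ∧ Function.Surjective f ∧
      Fintype.card C < Fintype.card A ∧ totalLength ρ < totalLength σ := by
  classical
  refine ⟨{c : A // c ≠ b}, inferInstance,
    fun c => if hc : c = b then ⟨a, hab⟩ else ⟨c, hc⟩, fun c => σ c, fun c => hσ c, ?_, ?_, ?_, ?_⟩
  · funext c
    by_cases hc : c = b
    · simp [compMor, hc, h]
    · simp [compMor, hc]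
  · rintro ⟨c, hc⟩
    exact ⟨c, by simp [hc]⟩
  · exact Fintype.card_subtype_lt (x := b) (by simp)
  · have h1 := Fintype.sum_subtype_add_sum_subtype (fun c => c ≠ b) (fun c => (σ c).length)
    have h2 : 0 < ∑ c : {c : A // ¬ c ≠ b}, (σ c).length :=
      Finset.sum_pos (fun c _ => List.length_pos_iff.mpr (hσ c)) ⟨⟨b, by simp⟩, by simp⟩
    simp only [totalLength]
    omega

/-- One step of the reduction: two letters whose images are comparable for the prefix order. -/
theorem exists_reduction_step [Fintype A] {σ : A → List B} (hσ : NonErasing σ) {a b : A}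
    (hab : a ≠ b) (h : σ a <+: σ b) :
    ∃ (C : Type u) (_ : Fintype C) (β : A → List C) (ρ : C → List B), NonErasing β ∧
      NonErasing ρ ∧ compMor ρ β = σ ∧ (∀ c, ∃ a, (β a).getLast? = some c) ∧
      Fintype.card C ≤ Fintype.card A ∧ totalLength ρ < totalLength σ ∧
      (Fintype.card C < Fintype.card A ∨ ∀ (y z u v : ℤ → _) (e f : ℤ → ℤ) (k : ℤ),
        IsRep β u y e → IsRep β v z f → e k = f k → y k = a → z k = b → u (e k + 1) ≠ v (e k + 1)) := by
  classical
  obtain ⟨w, hw⟩ := h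
  by_cases hw0 : w = []
  · subst hw0
    rw [List.append_nil] at hw
    obtain ⟨C, hC, f, ρ, h1, h2, h3, h4, h5⟩ := exists_factor_of_eq hσ hab hw
    exact ⟨C, hC, fun a => [f a], ρ, fun a => by simp, h1, h2,
      fun c => (h3 c).imp fun a ha => by simp [ha], h4.le, h5, Or.inl h4⟩
  -- Since `σ b = σ a ++ w` with `w` non-empty, `b` is expanded to the word `ab`, and the new image
  -- of `b` is only `w`.
  refine ⟨A, inferInstance, fun c => if c = b then [a, b] else [c],
    fun c => if c = b then w else σ c, fun c => ?_, fun c => ?_, ?_, fun c => ⟨c, ?_⟩, le_rfl,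
    ?_, Or.inr ?_⟩
  · dsimp only; split_ifs <;> simp
  · dsimp only; split_ifs
    · exact hw0
    · exact hσ c
  · funext c
    by_cases hc : c = b
    · simp [compMor, hc, hab, hw]
    · simp [compMor, hc]
  · by_cases hc : c = b <;> simp [hc]
  · refine Finset.sum_lt_sum (fun c _ => ?_) ⟨b, by simp, ?_⟩
    · by_cases hc : c = b
      · simp [hc, ← hw]
      · simp [hc]
    · have := List.length_pos_iff.mpr (hσ a)
      simp only [if_true, ← hw, List.length_append]; omega
  -- After the common letter `a`, `v` continues with `b`, while `u` continues with the first letter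
  -- of a `β`-image, which is never `b`: the disagreement survives.
  · intro y z u v e f k hu hv hef hy hz
    have h1 := hv.reads k
    have h2 := hu.step k
    have h3 := hu.reads (k + 1)
    simp only [hy, hz, if_true, hab, if_false, List.length_singleton, Nat.cast_one] at h1 h2
    rw [reads_cons, reads_singleton, ← hef] at h1
    rw [← h2] at h1 ⊢
    rw [h1.2]
    by_cases hc : y (k + 1) = b
    · simp only [hc, if_true, reads_cons] at h3
      rw [h3.1]; exact hab
    · simp only [hc, if_false, reads_singleton] at h3
      rw [h3]; exact hc

/-- If a sequence has two representations with a common cut, the morphism factors through an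
alphabet that is not larger, and is smaller if the representations differ to the right of it. -/
theorem exists_right_reduction (N : ℕ) : ∀ {A : Type u} [Fintype A] {σ : A → List B},
    NonErasing σ → totalLength σ ≤ N → ∀ {x : ℤ → B} {y z : ℤ → A} {c d : ℤ → ℤ},
    IsRep σ x y c → IsRep σ x z d → c 0 = d 0 →
    ∃ (C : Type u) (_ : Fintype C) (γ : A → List C) (ρ : C → List B), NonErasing γ ∧
      NonErasing ρ ∧ compMor ρ γ = σ ∧ (∀ c, ∃ a, (γ a).getLast? = some c) ∧
      Fintype.card C ≤ Fintype.card A ∧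
      ((∃ k, 0 ≤ k ∧ y k ≠ z k) → Fintype.card C < Fintype.card A) := by
  classical
  induction N with
  | zero =>
    intro A _ σ hσ hN x y z c d hy hz h0
    have h1 := List.length_pos_iff.mpr (hσ (y 0))
    have h2 := Finset.single_le_sum (f := fun a => (σ a).length) (fun a _ => Nat.zero_le _)
      (Finset.mem_univ (y 0))
    unfold totalLength at hN
    omega
  | succ N ih =>
    intro A _ σ hσ hN x y z c d hy hz h0
    by_cases hyz : ∃ k : ℕ, y k ≠ z k
    swap
    · push Not at hyz
      have hyz' : ∀ k : ℤ, 0 ≤ k → y k = z k := fun k hk => by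
        lift k to ℕ using hk; exact hyz k
      refine ⟨A, inferInstance, fun a => [a], σ, fun a => by simp, hσ, ?_, fun c => ⟨c, by simp⟩,
        le_rfl, fun ⟨k, hk, hk'⟩ => (hk' (hyz' k hk)).elim⟩
      funext a; simp [compMor]
    set k := Nat.find hyz
    have hk : y k ≠ z k := Nat.find_spec hyz
    have hlt : ∀ i : ℕ, i < k → y i = z i := fun i hi => not_not.1 (Nat.find_min hyz hi)
    have hcut : ∀ {D : Type u} {γ : A → List D} {u v : ℤ → D} {e f : ℤ → ℤ}, IsRep γ u y e →
        IsRep γ v z f → e 0 = f 0 → ∀ i : ℕ, i ≤ k → e i = f i := by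
      intro D γ u v e f hu hv h i
      induction i with
      | zero => intro _; exact h
      | succ i ih =>
        intro hi
        push_cast
        rw [hu.step, hv.step, ih (by omega), hlt i (by omega)]
    -- At the first disagreement `k` the cuts still coincide, so both images are read from the same
    -- position and one is a prefix of the other.
    have step : ∃ (C : Type u) (_ : Fintype C) (β : A → List C) (ρ : C → List B), NonErasing β ∧
      NonErasing ρ ∧ compMor ρ β = σ ∧ (∀ c, ∃ a, (β a).getLast? = some c) ∧
      Fintype.card C ≤ Fintype.card A ∧ totalLength ρ < totalLength σ ∧
      (Fintype.card C < Fintype.card A ∨ ∀ (u v : ℤ → _) (e f : ℤ → ℤ),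
        IsRep β u y e → IsRep β v z f → e k = f k → u (e k + 1) ≠ v (e k + 1)) := by
      have hr := hz.reads k
      rw [← hcut hy hz h0 k le_rfl] at hr
      rcases le_total (σ (y k)).length (σ (z k)).length with hl | hl
      · obtain ⟨C, hC, β, ρ, h1, h2, h3, h4, h5, h6, h7⟩ :=
          exists_reduction_step hσ hk ((hy.reads k).prefix hr hl)
        exact ⟨C, hC, β, ρ, h1, h2, h3, h4, h5, h6, h7.imp_right fun h u v e f hu hv hef =>
          h y z u v e f k hu hv hef rfl rfl⟩
      · obtain ⟨C, hC, β, ρ, h1, h2, h3, h4, h5, h6, h7⟩ :=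
          exists_reduction_step hσ hk.symm (hr.prefix (hy.reads k) hl)
        exact ⟨C, hC, β, ρ, h1, h2, h3, h4, h5, h6, h7.imp_right fun h u v e f hu hv hef => by
          rw [hef]; exact (h z y v u f e k hv hu hef.symm rfl rfl).symm⟩
    obtain ⟨C, hC, β, ρ, hβ, hρ, hρβ, hlast, hcard, htot, hdiff⟩ := step
    obtain ⟨u, e, hu, he⟩ := exists_isRep hβ y 0 0
    obtain ⟨v, f, hv, hf⟩ := exists_isRep hβ z 0 0
    subst hρβ
    obtain ⟨c', hc', hce⟩ := hy.decomp hρ hσ hu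
    obtain ⟨d', hd', hdf⟩ := hz.decomp hρ hσ hv
    obtain ⟨D, hD, γ, ρ', hγ, hρ', hργ, hlast', hcard', hcardlt⟩ :=
      ih hρ (by omega) hc' hd' (by rw [← he, hce, he, h0, ← hdf, hf])
    refine ⟨D, hD, compMor γ β, ρ', hγ.comp hβ, hρ', ?_, fun c => ?_, hcard'.trans hcard,
      fun _ => ?_⟩
    · rw [← compMor_assoc, hργ]
    · obtain ⟨b, hb⟩ := hlast' c
      obtain ⟨a, ha⟩ := hlast b
      obtain ⟨w, hw⟩ := List.getLast?_eq_some_iff.1 ha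
      obtain ⟨w', hw'⟩ := List.getLast?_eq_some_iff.1 hb
      exact ⟨a, List.getLast?_eq_some_iff.2 ⟨w.flatMap γ ++ w', by simp [compMor, hw, hw']⟩⟩
    -- Either a letter has already been lost, or the new sequences disagree at the non-negative
    -- index `e k + 1` and the induction hypothesis loses one.
    · rcases hdiff with h | h
      · exact hcard'.trans_lt h
      · refine (hcardlt ⟨_, ?_, h u v e f hu hv (hcut hu hv (he.trans hf.symm) k le_rfl)⟩).trans_le
          hcard
        have := (hu.strictMono hβ).monotone (show (0 : ℤ) ≤ (k : ℕ) by omega)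
        omega

/-- A morphism is elementary if it does not factor through a smaller alphabet. -/
def Elementary [Fintype A] (σ : A → List B) : Prop :=
  ∀ (C : Type u) [Fintype C] (γ : A → List C) (ρ : C → List B), NonErasing γ → NonErasing ρ →
    compMor ρ γ = σ → Fintype.card A ≤ Fintype.card C

theorem NonErasing.reverse {A B : Type*} {σ : A → List B} (hσ : NonErasing σ) :
    NonErasing fun a => (σ a).reverse := fun a => by simpa using hσ a

theorem compMor_reverse {A B C : Type*} (α : B → List C) (β : A → List B) :
    compMor (fun b => (α b).reverse) (fun a => (β a).reverse)
      = fun a => (compMor α β a).reverse := by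
  funext a
  simp [compMor, List.reverse_flatMap, Function.comp_def]

theorem Elementary.reverse [Fintype A] {σ : A → List B} (h : Elementary σ) :
    Elementary fun a => (σ a).reverse := by
  intro C _ γ ρ hγ hρ hργ
  refine h C _ _ hγ.reverse hρ.reverse ?_
  rw [compMor_reverse, hργ]
  simp

/-- An elementary morphism has at most one representation with a given cut. -/
theorem Elementary.seq_eq [Fintype A] {σ : A → List B} (hE : Elementary σ) (hσ : NonErasing σ)
    {x : ℤ → B} {y z : ℤ → A} {c d : ℤ → ℤ} (hy : IsRep σ x y c) (hz : IsRep σ x z d)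
    (h0 : c 0 = d 0) : y = z := by
  have key : ∀ {σ : A → List B}, Elementary σ → NonErasing σ → ∀ {x : ℤ → B} {y z : ℤ → A}
      {c d : ℤ → ℤ}, IsRep σ x y c → IsRep σ x z d → c 0 = d 0 → ∀ k, 0 ≤ k → y k = z k := by
    intro σ hE hσ x y z c d hy hz h0
    obtain ⟨C, hC, γ, ρ, hγ, hρ, hργ, -, -, hlt⟩ :=
      exists_right_reduction _ hσ le_rfl hy hz h0
    by_contra! hne
    exact (hlt hne).not_ge (hE C γ ρ hγ hρ hργ)
  funext k
  rcases le_or_gt 0 k with hk | hk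
  · exact key hE hσ hy hz h0 k hk
  · have := key hE.reverse hσ.reverse hy.reverse hz.reverse (by simp [h0]) (-1 - k) (by omega)
    simpa using this

end Reduction

/-! ### Itineraries and representations without a common cut -/

/-- The itinerary of a representation: `s p` consists of the letter whose image covers the
position `p`, and of the offset of `p` in this image. -/
structure IsItinerary {A B : Type*} (σ : A → List B) (x : ℤ → B) (s : ℤ → A × ℕ) : Prop where
  read : ∀ p, (σ (s p).1)[(s p).2]? = some (x p)
  step : ∀ p, s (p + 1) = ((s p).1, (s p).2 + 1) ∨
    ((s p).2 + 1 = (σ (s p).1).length ∧ (s (p + 1)).2 = 0)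

namespace IsItinerary

variable {A B : Type*} {σ : A → List B} {x : ℤ → B} {s : ℤ → A × ℕ} {p q : ℤ}

theorem offset_lt (h : IsItinerary σ x s) (p : ℤ) : (s p).2 < (σ (s p).1).length :=
  (List.getElem?_eq_some_iff.mp (h.read p)).1

theorem seq_eq (h : IsItinerary σ x s) (hs : s p = s q) : x p = x q := by
  have := h.read p
  rw [hs, h.read q] at this
  exact (Option.some_injective _ this).symm

theorem next_of_ne (h : IsItinerary σ x s) (hs : s p = s q) (h0 : (s (p + 1)).2 ≠ 0) :
    s (p + 1) = s (q + 1) := by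
  rcases h.step p with h1 | h1
  · rcases h.step q with h2 | h2
    · rw [h1, h2, hs]
    · have := h.offset_lt (p + 1)
      rw [h1, hs] at this
      dsimp only at this
      omega
  · exact (h0 h1.2).elim

theorem prev_of_ne (h : IsItinerary σ x s) (hs : s (p + 1) = s (q + 1))
    (h0 : (s (p + 1)).2 ≠ 0) : s p = s q := by
  rcases h.step p with h1 | h1
  · rcases h.step q with h2 | h2
    · rw [h1, h2, Prod.mk.injEq, add_left_inj] at hs
      exact Prod.ext hs.1 hs.2
    · rw [hs] at h0; exact (h0 h2.2).elim
  · exact (h0 h1.2).elim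

theorem next_of_head (h : IsItinerary σ x s) (hσ : ∀ a b, (σ a).head? = (σ b).head? → a = b)
    (hs : s p = s q) (hx : x (p + 1) = x (q + 1)) : s (p + 1) = s (q + 1) := by
  by_cases h0 : (s (p + 1)).2 = 0
  · by_cases h1 : (s (q + 1)).2 = 0
    · refine Prod.ext (hσ _ _ ?_) (h0.trans h1.symm)
      have h2 := h.read (p + 1)
      have h3 := h.read (q + 1)
      rw [h0] at h2
      rw [h1] at h3
      rw [List.head?_eq_getElem?, List.head?_eq_getElem?, h2, h3, hx]
    · exact (h.next_of_ne hs.symm h1).symm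
  · exact h.next_of_ne hs h0

theorem prev_of_getLast (h : IsItinerary σ x s)
    (hσ : ∀ a b, (σ a).getLast? = (σ b).getLast? → a = b)
    (hs : s (p + 1) = s (q + 1)) (hx : x p = x q) : s p = s q := by
  by_cases h0 : (s (p + 1)).2 = 0
  · have hlast : ∀ p, (s (p + 1)).2 = 0 →
        (s p).2 = (σ (s p).1).length - 1 ∧ (σ (s p).1).getLast? = some (x p) := by
      intro p h0
      rcases h.step p with h1 | h1
      · rw [h1] at h0; simp at h0
      · have h2 := h.read p
        rw [show (s p).2 = (σ (s p).1).length - 1 by omega] at h2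
        exact ⟨by omega, by rw [List.getLast?_eq_getElem?, h2]⟩
    obtain ⟨h1, h2⟩ := hlast p h0
    obtain ⟨h3, h4⟩ := hlast q (hs ▸ h0)
    have h5 : (s p).1 = (s q).1 := hσ _ _ (by rw [h2, h4, hx])
    exact Prod.ext h5 (by rw [h1, h3, h5])
  · exact h.prev_of_ne hs h0

end IsItinerary

theorem IsRep.exists_itinerary {A B : Type*} {σ : A → List B} {x : ℤ → B} {y : ℤ → A} {c : ℤ → ℤ}
    (hσ : NonErasing σ) (h : IsRep σ x y c) :
    ∃ s, IsItinerary σ x s ∧ ∀ p, (s p).2 = 0 → ∃ k, c k = p := by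
  choose b i hi hp using h.exists_offset hσ
  refine ⟨fun p => (y (b p), i p), ⟨fun p => ?_, fun p => ?_⟩, fun p h0 => ⟨b p, ?_⟩⟩
  · dsimp only
    conv_rhs => rw [hp p]
    rw [h.reads (b p) (i p) _ (List.getElem?_eq_getElem (hi p))]
    exact List.getElem?_eq_getElem (hi p)
  · have hm := h.strictMono hσ
    have h1 := hi p
    have h2 := hp p
    have h3 := h.step (b p)
    have h4 := hp (p + 1)
    have h5 := h.step (b (p + 1))
    have h6 := hi (p + 1)
    rcases Nat.lt_or_ge (i p + 1) (σ (y (b p))).length with hl | hl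
    · left
      have : b (p + 1) = b p :=
        hm.int_block_unique (m := p + 1) (by omega) (by omega) (by omega) (by omega)
      rw [this] at h4
      simp only [this, Prod.mk.injEq, true_and]
      omega
    · right
      have : b (p + 1) = b p + 1 := by
        have h7 := h.step (b p + 1)
        have := List.length_pos_iff.mpr (hσ (y (b p + 1)))
        exact hm.int_block_unique (m := p + 1) (by omega) (by omega) (by omega) (by omega)
      rw [this] at h4
      dsimp only
      omega
  · have := hp p
    dsimp only at h0
    omega

/-- Without a common cut, at each position at least one of the two itineraries is inside a block, so
its state is forced by the neighbouring one. That state gives the letter of `x`, which forces the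
other itinerary through the first letter (going right) or the last letter (going left). The pair is
thus deterministic both ways with finitely many states, and a repetition makes `x` periodic. -/
theorem exists_common_cut_of_injective {A B : Type*} [Fintype A] {σ : A → List B}
    (hσ : NonErasing σ) (hhead : ∀ a b, (σ a).head? = (σ b).head? → a = b)
    (hlast : ∀ a b, (σ a).getLast? = (σ b).getLast? → a = b) {x : ℤ → B} {y z : ℤ → A}
    {c d : ℤ → ℤ} (hy : IsRep σ x y c) (hz : IsRep σ x z d) (hx : AperiodicSeq x) :
    ∃ k l, c k = d l := by
  by_contra! hcd
  obtain ⟨s, hs, hsc⟩ := hy.exists_itinerary hσ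
  obtain ⟨t, ht, htd⟩ := hz.exists_itinerary hσ
  have hst : ∀ p, (s p).2 ≠ 0 ∨ (t p).2 ≠ 0 := by
    intro p
    by_contra! h
    obtain ⟨k, hk⟩ := hsc p h.1
    obtain ⟨l, hl⟩ := htd p h.2
    exact hcd k l (hk.trans hl.symm)
  have hnext : ∀ p q, s p = s q ∧ t p = t q → s (p + 1) = s (q + 1) ∧ t (p + 1) = t (q + 1) := by
    rintro p q ⟨h1, h2⟩
    rcases hst (p + 1) with h | h
    · have := hs.next_of_ne h1 h
      exact ⟨this, ht.next_of_head hhead h2 (hs.seq_eq this)⟩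
    · have := ht.next_of_ne h2 h
      exact ⟨hs.next_of_head hhead h1 (ht.seq_eq this), this⟩
  have hprev : ∀ p q, s (p + 1) = s (q + 1) ∧ t (p + 1) = t (q + 1) → s p = s q ∧ t p = t q := by
    rintro p q ⟨h1, h2⟩
    rcases hst (p + 1) with h | h
    · have := hs.prev_of_ne h1 h
      exact ⟨this, ht.prev_of_getLast hlast h2 (hs.seq_eq this)⟩
    · have := ht.prev_of_ne h2 h
      exact ⟨hs.prev_of_getLast hlast h1 (ht.seq_eq this), this⟩
  have hper : ∃ p q, p < q ∧ s p = s q ∧ t p = t q := by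
    have hb : ∀ {s}, IsItinerary σ x s → ∀ p, (s p).2 < ∑ a, (σ a).length := fun h p =>
      (h.offset_lt p).trans_le
        (Finset.single_le_sum (f := fun a => (σ a).length) (fun _ _ => Nat.zero_le _)
          (Finset.mem_univ _))
    let F : ℤ → (A × Fin (∑ a, (σ a).length)) × (A × Fin (∑ a, (σ a).length)) := fun p =>
      (((s p).1, ⟨(s p).2, hb hs p⟩), ((t p).1, ⟨(t p).2, hb ht p⟩))
    obtain ⟨p, q, hpq, hF⟩ := Finite.exists_ne_map_eq_of_infinite F
    simp only [F, Prod.mk.injEq, Fin.mk.injEq] at hF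
    rcases lt_or_gt_of_ne hpq with h | h
    · exact ⟨p, q, h, Prod.ext hF.1.1 hF.1.2, Prod.ext hF.2.1 hF.2.2⟩
    · exact ⟨q, p, h, (Prod.ext hF.1.1 hF.1.2).symm, (Prod.ext hF.2.1 hF.2.2).symm⟩
  obtain ⟨p, q, hpq, h0⟩ := hper
  refine hx (q - p) (by omega) fun k => hs.seq_eq (And.left (?_ : _ ∧ t (k + (q - p)) = t k))
  refine Int.inductionOn' (motive := fun k => s (k + (q - p)) = s k ∧ t (k + (q - p)) = t k) k p
    ?_ (fun k _ ih => ?_) fun k _ ih => ?_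
  · rw [add_sub_cancel]; exact ⟨h0.1.symm, h0.2.symm⟩
  · rw [show k + 1 + (q - p) = k + (q - p) + 1 by ring]; exact hnext _ _ ih
  · refine hprev _ _ ?_
    rw [show k - 1 + (q - p) + 1 = k + (q - p) by ring, sub_add_cancel]; exact ih

theorem IsRep.getLast?_eq {A B : Type*} {σ : A → List B} {x : ℤ → B} {y : ℤ → A} {c : ℤ → ℤ}
    (hσ : NonErasing σ) (h : IsRep σ x y c) (k : ℤ) :
    (σ (y k)).getLast? = some (x (c (k + 1) - 1)) := by
  have hl := List.length_pos_iff.mpr (hσ (y k))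
  rw [List.getLast?_eq_getElem?, List.getElem?_eq_getElem (by omega),
    ← h.reads k _ _ (List.getElem?_eq_getElem (show (σ (y k)).length - 1 < _ by omega)), h.step]
  congr 2
  omega

theorem length_eq_one_of_length_flatMap_eq {A B : Type*} {ρ : A → List B} (hρ : NonErasing ρ)
    {w : List A} (h : (w.flatMap ρ).length = w.length) : ∀ a ∈ w, (ρ a).length = 1 := by
  have hle : ∀ w : List A, w.length ≤ (w.flatMap ρ).length := fun w =>
    length_le_compMor hρ (fun _ : Unit => w) ()
  induction w with
  | nil => simp
  | cons a w ih =>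
    have h1 := hle w
    have h2 := List.length_pos_iff.mpr (hρ a)
    simp only [List.flatMap_cons, List.length_cons, List.length_append] at h
    intro b hb
    rcases List.mem_cons.1 hb with rfl | hb
    · omega
    · exact ih (by omega) b hb

/-! ### Recognizability of elementary morphisms -/

section Elementary

variable {A B : Type u} [Fintype A]

theorem Elementary.of_comp {C : Type u} {σ : A → List B} (hE : Elementary σ) {γ : A → List C}
    {ρ : C → List B} (hρ : NonErasing ρ) (h : compMor ρ γ = σ) : Elementary γ := by
  intro D _ γ' ρ' hγ' hρ' h'
  exact hE D γ' (compMor ρ ρ') hγ' (hρ.comp hρ') (by rw [compMor_assoc, h', h])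

theorem Elementary.of_comp_of_card {C : Type u} [Fintype C] {σ : A → List B} (hE : Elementary σ)
    {γ : A → List C} {ρ : C → List B} (hγ : NonErasing γ) (h : compMor ρ γ = σ)
    (hC : Fintype.card C ≤ Fintype.card A) : Elementary ρ := by
  intro D _ γ' ρ' hγ' hρ' h'
  exact hC.trans (hE D (compMor γ' γ) ρ' (hγ'.comp hγ) hρ' (by rw [← compMor_assoc, h', h]))

/-- A cut of `z` falls strictly inside a block `σ a` of `y`. Splitting `a` there into two letters
costs one letter and creates a common cut, and the right reduction regains that letter, giving `σ =
ρ ∘ (γ ∘ β)` with `ρ` elementary on `card A` letters. Minimality of total length (the hypothesis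
`H`) makes `ρ` letter-to-letter, and counting shows that the last letters of the words `γ(β(b))` are
distinct. -/
theorem Elementary.getLast?_injective {σ : A → List B} (hE : Elementary σ) (hσ : NonErasing σ)
    (H : ∀ {C : Type u} {δ : A → List C}, NonErasing δ → Elementary δ →
      totalLength δ < totalLength σ → ∀ {x : ℤ → C} {y z : ℤ → A} {c d : ℤ → ℤ}, IsRep δ x y c →
      IsRep δ x z d → AperiodicSeq x → ∃ k l, c k = d l)
    {x : ℤ → B} {y z : ℤ → A} {c d : ℤ → ℤ} (hy : IsRep σ x y c) (hz : IsRep σ x z d)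
    (hx : AperiodicSeq x) (hcd : ∀ k l, c k ≠ d l) (b b' : A)
    (hbb : (σ b).getLast? = (σ b').getLast?) : b = b' := by
  classical
  wlog hk0 : c 0 ≤ d 0 ∧ d 0 < c 1 generalizing y c with W
  · obtain ⟨k, h1, h2⟩ := (hy.strictMono hσ).exists_int_block (d 0)
    exact W (hy.reindex k) (fun _ => hcd _) ⟨by simpa using h1, by simpa [add_comm] using h2⟩
  obtain ⟨a, ha⟩ : ∃ a, y 0 = a := ⟨_, rfl⟩
  obtain ⟨i, hi⟩ : ∃ i : ℕ, d 0 = c 0 + i := ⟨(d 0 - c 0).toNat, by omega⟩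
  have hi0 : i ≠ 0 := fun h => hcd 0 0 (by rw [hi, h]; simp)
  have hil : i < (σ a).length := by
    have := hy.step 0
    rw [zero_add, ha] at this; omega
  -- split the letter `a` at the cut `d 0`
  let β : A → List (Option A) := fun b => if b = a then [some a, none] else [some b]
  let σ' : Option A → List B := fun o =>
    o.elim ((σ a).drop i) fun b => if b = a then (σ a).take i else σ b
  have hβ : NonErasing β := fun b => by dsimp only [β]; split_ifs <;> simp
  have hσ' : NonErasing σ' := by
    rintro (_ | b)
    · simpa [σ'] using hil
    · by_cases hb : b = a
      · simp only [σ', Option.elim, hb, if_true, ne_eq, List.take_eq_nil_iff, hi0, false_or]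
        exact hσ a
      · simpa [σ', hb] using hσ b
  have hσβ : compMor σ' β = σ := by
    funext b
    by_cases hb : b = a
    · simp [compMor, β, σ', hb]
    · simp [compMor, β, σ', hb]
  have hβlast : ∀ b, (β b).getLast? = some (if b = a then none else some b) := fun b => by
    by_cases hb : b = a <;> simp [β, hb]
  -- The block of `y 0 = a` starts at `-1`, so its second half `none` has index `0`, where the block
  -- of `z 0` starts as well.
  obtain ⟨y', e, hy', he⟩ := exists_isRep hβ y 0 (-1)
  obtain ⟨z', f, hz', hf⟩ := exists_isRep hβ z 0 0
  have hσn : NonErasing (compMor σ' β) := by rwa [hσβ]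
  obtain ⟨c', hc', hce⟩ := IsRep.decomp hσ' hσn (by rwa [hσβ]) hy'
  obtain ⟨d', hd', hdf⟩ := IsRep.decomp hσ' hσn (by rwa [hσβ]) hz'
  have hya : y' (-1) = some a ∧ y' 0 = none := by
    have := hy'.reads 0
    simpa [he, ha, β, reads_cons, reads_nil] using this
  have hcut : c' 0 = d' 0 := by
    have h1 := hc'.step (-1)
    have h2 := hce 0
    have h3 := hdf 0
    rw [he] at h2
    rw [hf] at h3
    rw [hya.1, h2, neg_add_cancel] at h1
    rw [h1, h3, hi]
    simp [σ', hil.le]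
  have hza : ∃ b, z' 0 = some b := by
    have := hz'.reads 0
    rw [hf] at this
    by_cases hb : z 0 = a
    · simp only [β, hb, if_true, reads_cons] at this
      exact ⟨_, this.1⟩
    · simp only [β, hb, if_false, reads_singleton] at this
      exact ⟨_, this⟩
  -- A word `β b` never ends in `some a`, because there `some a` is always followed by `none`.
  have hzl : z' (-1) ≠ some a := by
    have h1 := hz'.getLast?_eq hβ (-1)
    rw [hβlast, neg_add_cancel, hf, zero_sub, Option.some_inj] at h1
    rw [← h1]
    by_cases hb : z (-1) = a <;> simp [hb]
  obtain ⟨C, hC, γ, ρ, hγ, hρ, hργ, hlast, -, hlt⟩ :=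
    exists_right_reduction _ hσ' le_rfl hc' hd' hcut
  have hfac : compMor ρ (compMor γ β) = σ := by rw [← compMor_assoc, hργ, hσβ]
  have hcard : Fintype.card A = Fintype.card C := by
    refine le_antisymm (hE C _ _ (hγ.comp hβ) hρ hfac) ?_
    have := hlt ⟨0, le_rfl, by obtain ⟨b, hb⟩ := hza; simp [hya.2, hb]⟩
    rw [Fintype.card_option] at this
    omega
  have hρE : Elementary ρ := hE.of_comp_of_card (hγ.comp hβ) hfac hcard.ge
  obtain ⟨u, g, hu, hg⟩ := exists_isRep hγ y' 0 0
  obtain ⟨v, h, hv, hh⟩ := exists_isRep hγ z' 0 0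
  rw [← hργ] at hσ' hc' hd'
  obtain ⟨c₂, hc₂, hcg⟩ := hc'.decomp hρ hσ' hu
  obtain ⟨d₂, hd₂, hdh⟩ := hd'.decomp hρ hσ' hv
  have hcut₂ : c₂ 0 = d₂ 0 := by
    have h1 := hcg 0
    have h2 := hdh 0
    rw [hg] at h1
    rw [hh] at h2
    rw [h1, h2, hcut]
  obtain rfl : u = v := hρE.seq_eq hρ hc₂ hd₂ hcut₂
  obtain rfl : c₂ = d₂ := hc₂.cut_eq hd₂ 0 hcut₂
  -- Otherwise `γ ∘ β` is elementary of smaller total length, and `H` gives a common cut of its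
  -- representations of `u`, which `ρ` carries to a common cut in `x`.
  have hlen : ∀ b, (compMor γ β b).length = (σ b).length := by
    have hle : ∀ b ∈ Finset.univ, (compMor γ β b).length ≤ (σ b).length := fun b _ => by
      rw [← hfac]; exact length_le_compMor hρ _ b
    by_contra! hne
    obtain ⟨b, hb⟩ := hne
    have hsum : totalLength (compMor γ β) < totalLength σ :=
      Finset.sum_lt_sum hle ⟨b, Finset.mem_univ b, lt_of_le_of_ne (hle b (Finset.mem_univ b)) hb⟩
    obtain ⟨k, l, hkl⟩ := H (hγ.comp hβ) (hE.of_comp hρ hfac) hsum (hy'.comp hu) (hz'.comp hv)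
      (hc₂.aperiodic hρ hx)
    refine hcd k l ?_
    rw [← hce, ← hcg, hkl, hdh, hdf]
  choose m hm using hlast
  -- the last letters of the images under `compMor γ β`
  have hex : ∀ o, ∃ t, (γ o).getLast? = some t := fun o =>
    ⟨_, List.getLast?_eq_some_getLast (hγ o)⟩
  choose ℓ hℓ using hex
  have hℓeq : ℓ (some a) = ℓ (z' (-1)) := by
    have h1 := hu.getLast?_eq hγ (-1)
    have h2 := hv.getLast?_eq hγ (-1)
    rw [neg_add_cancel, hg, hya.1, hℓ] at h1
    rw [neg_add_cancel, hh, hℓ] at h2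
    exact Option.some_injective _ (h1.trans h2.symm)
  let L : A → C := fun b => ℓ (if b = a then none else some b)
  -- Every letter of `C` ends some `γ o`. The one case not reached directly, `o = some a`, is
  -- replaced by `z' (-1)`, whose image ends at the same cut of `u`.
  have hLsurj : Function.Surjective L := by
    have key : ∀ o : Option A, o ≠ some a → ∃ b, L b = ℓ o := by
      rintro (_ | b) ho
      · exact ⟨a, by simp [L]⟩
      · have : b ≠ a := fun h => ho (by rw [h])
        exact ⟨b, by simp [L, this]⟩
    intro t
    have ht : ℓ (m t) = t := by
      have := hm t
      rw [hℓ] at this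
      exact Option.some_injective _ this
    by_cases hmt : m t = some a
    · obtain ⟨b, hb⟩ := key _ hzl
      exact ⟨b, by rw [hb, ← hℓeq, ← hmt, ht]⟩
    · obtain ⟨b, hb⟩ := key _ hmt
      exact ⟨b, by rw [hb, ht]⟩
  have hLinj : Function.Injective L :=
    ((Fintype.bijective_iff_surjective_and_card L).2 ⟨hLsurj, hcard⟩).1
  have hL : ∀ b, ∃ w, compMor γ β b = w ++ [L b] := fun b => by
    obtain ⟨w, hw⟩ := List.getLast?_eq_some_iff.1 (hβlast b)
    obtain ⟨w', hw'⟩ := List.getLast?_eq_some_iff.1 (hℓ (if b = a then none else some b))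
    exact ⟨w.flatMap γ ++ w', by
      rw [compMor, hw, List.flatMap_append, List.flatMap_singleton, hw', List.append_assoc]⟩
  have hρ1 : ∀ t, (ρ t).length = 1 := fun t => by
    obtain ⟨b, rfl⟩ := hLsurj t
    obtain ⟨w, hw⟩ := hL b
    refine length_eq_one_of_length_flatMap_eq hρ (w := compMor γ β b) ?_ _ (by simp [hw])
    rw [hlen b, ← hfac]; rfl
  have hρinj : Function.Injective ρ := by
    intro s t hst
    by_contra hne
    obtain ⟨D, hD, F, ρ', h1, h2, -, h3, -⟩ := exists_factor_of_eq hρ hne hst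
    exact h3.not_ge (hρE D _ ρ' (fun _ => by simp) h1 h2)
  have hσL : ∀ b, (σ b).getLast? = (ρ (L b)).getLast? := fun b => by
    obtain ⟨w, hw⟩ := hL b
    rw [← hfac, compMor, hw, List.flatMap_append, List.flatMap_singleton,
      List.getLast?_append_of_ne_nil _ (hρ _)]
  refine hLinj (hρinj ?_)
  rw [hσL, hσL] at hbb
  obtain ⟨p, hp⟩ := List.length_eq_one_iff.1 (hρ1 (L b))
  obtain ⟨q, hq⟩ := List.length_eq_one_iff.1 (hρ1 (L b'))
  rw [hp, hq] at hbb ⊢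
  simpa using hbb

/-- Induction on total length supplies the hypothesis `H` of `Elementary.getLast?_injective`; first
letters are handled by the mirror image. -/
theorem Elementary.exists_common_cut_aux (N : ℕ) : ∀ {B : Type u} {σ : A → List B},
    NonErasing σ → Elementary σ → totalLength σ < N → ∀ {x : ℤ → B} {y z : ℤ → A} {c d : ℤ → ℤ},
    IsRep σ x y c → IsRep σ x z d → AperiodicSeq x → ∃ k l, c k = d l := by
  induction N with
  | zero => intro B σ _ _ h; omega
  | succ N ih =>
    intro B σ hσ hE hN x y z c d hy hz hx
    by_contra! hcd
    obtain ⟨k, l, hkl⟩ := exists_common_cut_of_injective hσ (fun a b hab =>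
      hE.reverse.getLast?_injective hσ.reverse
        (fun h1 h2 h3 => ih h1 h2 (h3.trans_le (by
          simp only [totalLength, List.length_reverse] at *; omega)))
        hy.reverse hz.reverse (fun p hp hper => hx p hp fun k => by
          have := hper (-1 - k - p)
          dsimp only at this
          rw [show -1 - (-1 - k - p + p) = k by ring,
            show -1 - (-1 - k - p) = k + p by ring] at this
          exact this.symm) (fun k l h => hcd _ _ (neg_injective h)) a b (by simpa using hab))
      (hE.getLast?_injective hσ (fun h1 h2 h3 => ih h1 h2 (h3.trans_le (by omega))) hy hz hx hcd)
      hy hz hx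
    exact hcd k l hkl

/-- Elementary morphisms are recognizable for aperiodic two-sided sequences. -/
theorem Elementary.exists_eq_reindex {σ : A → List B} (hE : Elementary σ) (hσ : NonErasing σ)
    {x : ℤ → B} {y z : ℤ → A} {c d : ℤ → ℤ} (hy : IsRep σ x y c) (hz : IsRep σ x z d)
    (hx : AperiodicSeq x) : ∃ m, ∀ k, z (k + m) = y k ∧ d (k + m) = c k := by
  obtain ⟨k, l, hkl⟩ := Elementary.exists_common_cut_aux _ hσ hE (Nat.lt_succ_self _) hy hz hx
  have h1 := hy.reindex k
  have h2 := hz.reindex l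
  have h3 := hE.seq_eq hσ h1 h2 (by simpa using hkl)
  rw [← h3] at h2
  have h4 := h1.cut_eq h2 0 (by simpa using hkl)
  refine ⟨l - k, fun j => ⟨?_, ?_⟩⟩
  · have := congrFun h3 (j - k)
    rw [sub_add_cancel] at this
    rw [this]; congr 1; ring
  · have := congrFun h4 (j - k)
    rw [sub_add_cancel] at this
    rw [this]; congr 1; ring

end Elementary

/-! ### Recognizability of arbitrary aperiodic substitutions -/

/-- A set of aperiodic two-sided sequences that is stable under a morphism and under
desubstitution. -/
structure IsSubstitutive {A : Type*} (σ : A → List A) (X : Set (ℤ → A)) : Prop where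
  image : ∀ {x y c}, y ∈ X → IsRep σ x y c → x ∈ X
  preimage : ∀ {x}, x ∈ X → ∃ y ∈ X, ∃ c, IsRep σ x y c
  aperiodic : ∀ {x}, x ∈ X → AperiodicSeq x

/-- Exchanging the two factors of a morphism. -/
theorem IsSubstitutive.conjugate {A C : Type*} {β : A → List C} {α : C → List A}
    (hβ : NonErasing β) (hα : NonErasing α) {X : Set (ℤ → A)}
    (hX : IsSubstitutive (compMor α β) X) :
    IsSubstitutive (compMor β α) {u | ∃ y ∈ X, ∃ c, IsRep β u y c} where
  image := by
    rintro u' u c' ⟨y, hy, c, hu⟩ hu'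
    obtain ⟨w, e, hw, -⟩ := exists_isRep hα u 0 0
    obtain ⟨f, hf, -⟩ := hu'.decomp hβ (hβ.comp hα) hw
    exact ⟨w, hX.image hy (hu.comp hw), f, hf⟩
  preimage := by
    rintro u ⟨y, hy, c, hu⟩
    obtain ⟨w, hw, d, hd⟩ := hX.preimage hy
    obtain ⟨v, e, hv, -⟩ := exists_isRep hβ w 0 0
    obtain ⟨f, hf, -⟩ := hd.decomp hα (hα.comp hβ) hv
    exact ⟨v, ⟨w, hw, e, hv⟩, _, hf.comp hu⟩
  aperiodic := by
    rintro u ⟨y, hy, c, hu⟩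
    -- An `α`-image of `u` lies in `X`, and it would be periodic if `u` were.
    obtain ⟨w, e, hw, -⟩ := exists_isRep hα u 0 0
    exact hw.aperiodic hα (hX.aperiodic (hX.image hy (hu.comp hw)))

/-- Induction on the alphabet size: for `σ = α ∘ β`, the induction hypothesis for `β ∘ α` is used
twice, one level above `x` to match the `β`-images of `y` and `z`, then one level below to match `y`
and `z` themselves. -/
theorem IsSubstitutive.exists_eq_reindex_aux (N : ℕ) : ∀ {A : Type u} [Fintype A]
    {σ : A → List A} {X : Set (ℤ → A)}, NonErasing σ → IsSubstitutive σ X → Fintype.card A < N →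
    ∀ {x y z : ℤ → A} {c d : ℤ → ℤ}, y ∈ X → z ∈ X → IsRep σ x y c → IsRep σ x z d →
    ∃ m, ∀ k, z (k + m) = y k ∧ d (k + m) = c k := by
  induction N with
  | zero => intro A _ σ X _ _ h; omega
  | succ N ih =>
    intro A _ σ X hσ hX hN x y z c d hyX hzX hy hz
    by_cases hE : Elementary σ
    · exact hE.exists_eq_reindex hσ hy hz (hX.aperiodic (hX.image hyX hy))
    unfold Elementary at hE
    push Not at hE
    obtain ⟨C, _, β, α, hβ, hα, rfl, hcard⟩ := hE
    have IH : ∀ {x y z : ℤ → C} {c d : ℤ → ℤ}, (∃ w ∈ X, ∃ c, IsRep β y w c) →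
        (∃ w ∈ X, ∃ c, IsRep β z w c) → IsRep (compMor β α) x y c → IsRep (compMor β α) x z d →
        ∃ m, ∀ k, z (k + m) = y k ∧ d (k + m) = c k := fun h1 h2 h3 h4 =>
      ih (hβ.comp hα) (hX.conjugate hβ hα) (by omega) h1 h2 h3 h4
    obtain ⟨u, e, hu, -⟩ := exists_isRep hβ y 0 0
    obtain ⟨v, e', hv, -⟩ := exists_isRep hβ z 0 0
    obtain ⟨f, hf, hfe⟩ := hy.decomp hα hσ hu
    obtain ⟨f', hf', hfe'⟩ := hz.decomp hα hσ hv
    obtain ⟨x', g, hg, -⟩ := exists_isRep hβ x 0 0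
    -- Both `u` and `v` represent the `β`-image of `x` under `β ∘ α`, hence agree up to a shift;
    -- injectivity of `g` then matches their `α`-cuts in `x`.
    obtain ⟨m, hm⟩ := IH ⟨y, hyX, e, hu⟩ ⟨z, hzX, e', hv⟩ (hf.comp hg) (hf'.comp hg)
    have hff : ∀ k, f' (k + m) = f k := fun k => (hg.strictMono hβ).injective (hm k).2
    have hv' := hv.translate m
    rw [show (fun k => v (k + m)) = u from funext fun k => (hm k).1] at hv'
    have lift : ∀ {y}, y ∈ X → ∃ p b, (∃ w ∈ X, ∃ c, IsRep β p w c) ∧ IsRep α y p b := by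
      intro y hy
      obtain ⟨w, hw, d, hd⟩ := hX.preimage hy
      obtain ⟨p, e, hp, -⟩ := exists_isRep hβ w 0 0
      obtain ⟨b, hb, -⟩ := hd.decomp hα hσ hp
      exact ⟨p, b, ⟨w, hw, e, hp⟩, hb⟩
    obtain ⟨p, b, hp, hpy⟩ := lift hyX
    obtain ⟨q, b', hq, hqz⟩ := lift hzX
    -- Desubstituting `y` and `z` through `α` gives two representations of `u` under `β ∘ α`;
    -- matching `p` with `q` matches their `α`-images `y` and `z`.
    obtain ⟨m', hm'⟩ := IH hp hq (hpy.comp hu) (hqz.comp hv')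
    set n := b' m' - b 0 with hn
    have h1 := (hqz.reindex m').translate n
    rw [show (fun k => q (k + m')) = p from funext fun k => (hm' k).1] at h1
    have h2 := h1.cut_eq hpy 0 (by simp [hn])
    rw [h2] at h1
    have hzy : (fun k => z (k + n)) = y := h1.seq_eq hα hpy
    have h3 := hv'.reindex n
    rw [hzy] at h3
    have h4 := h3.cut_eq hu (b 0) (by
      have := (hm' 0).2
      rw [zero_add] at this
      rw [← this]
      simp [hn])
    refine ⟨n, fun k => ⟨congrFun hzy k, ?_⟩⟩
    have := congrFun h4 k
    rw [← hfe', ← hfe, ← hff, ← this, sub_add_cancel]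

/-- Aperiodic substitutions are recognizable. -/
theorem IsSubstitutive.exists_eq_reindex {A : Type u} [Finite A] {σ : A → List A}
    {X : Set (ℤ → A)} (hX : IsSubstitutive σ X) (hσ : NonErasing σ) {x y z : ℤ → A} {c d : ℤ → ℤ}
    (hyX : y ∈ X) (hzX : z ∈ X) (hy : IsRep σ x y c) (hz : IsRep σ x z d) :
    ∃ m, ∀ k, z (k + m) = y k ∧ d (k + m) = c k := by
  have := Fintype.ofFinite A
  exact IsSubstitutive.exists_eq_reindex_aux _ hσ hX (Nat.lt_succ_self _) hyX hzX hy hz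

theorem Reads.infix {B : Type*} {x : ℤ → B} {p q : ℤ} {v w : List B} (hv : Reads x p v)
    (hw : Reads x q w) (h1 : q ≤ p) (h2 : p + v.length ≤ q + w.length) : v <:+: w := by
  obtain ⟨i, rfl⟩ : ∃ i : ℕ, p = q + i := ⟨(p - q).toNat, by omega⟩
  have hi : i ≤ w.length := by omega
  have h3 := hw
  rw [← List.take_append_drop i w, reads_append, List.length_take_of_le hi] at h3
  exact (hv.prefix h3.2 (by rw [List.length_drop]; omega)).isInfix.trans
    (List.drop_suffix i w).isInfix

theorem reads_ofFn {B : Type*} (x : ℤ → B) (p : ℤ) (l : ℕ) :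
    Reads x p (List.ofFn fun i : Fin l => x (p + (i : ℕ))) := by
  intro j b hj
  rw [List.getElem?_ofFn] at hj
  split_ifs at hj
  simpa using hj

theorem exists_split_of_lt_length_flatMap {A B : Type*} (τ : A → List B) {W : List A} {i : ℕ}
    (hi : i < (W.flatMap τ).length) : ∃ w b w', W = w ++ b :: w' ∧
      ∃ j, i = (w.flatMap τ).length + j ∧ j < (τ b).length := by
  induction W generalizing i with
  | nil => simp at hi
  | cons a W ih =>
    rcases lt_or_ge i (τ a).length with h | h
    · exact ⟨[], a, W, rfl, i, by simp, h⟩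
    · rw [List.flatMap_cons, List.length_append] at hi
      obtain ⟨w, b, w', rfl, j, hj, hj'⟩ := ih (i := i - (τ a).length) (by omega)
      refine ⟨a :: w, b, w', rfl, j, ?_, hj'⟩
      rw [List.flatMap_cons, List.length_append]; omega

theorem IsSubstitutive.comp {A : Type*} {τ σ : A → List A} {X : Set (ℤ → A)}
    (hτ : NonErasing τ) (hσ : NonErasing σ) (h : IsSubstitutive τ X) (h' : IsSubstitutive σ X) :
    IsSubstitutive (compMor τ σ) X where
  image := by
    intro x y c hy hx
    obtain ⟨u, d, hu, -⟩ := exists_isRep hσ y 0 0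
    obtain ⟨f, hf, -⟩ := hx.decomp hτ (hτ.comp hσ) hu
    exact h.image (h'.image hy hu) hf
  preimage := by
    intro x hx
    obtain ⟨u, hu, c, hc⟩ := h.preimage hx
    obtain ⟨y, hy, d, hd⟩ := h'.preimage hu
    exact ⟨y, hy, _, hd.comp hc⟩
  aperiodic := h.aperiodic

/-! ### Tower levels and desubstitution in the substitution space -/

namespace Substitution

variable {A : Type*} (σ : Substitution A)

theorem nonErasing_img : NonErasing σ.img := σ.img_ne_nil

theorem isRep_onSeq (y : ℤ → A) : IsRep σ.img (σ.onSeq y) y (σ.cut y) where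
  step := σ.cut_succ y
  reads k j b hj := by
    obtain ⟨hl, rfl⟩ := List.getElem?_eq_some_iff.mp hj
    exact σ.onSeq_cut_add y k j hl

theorem powImg_zero : σ.powImg 0 = fun a => [a] := rfl

theorem powImg_succ (n : ℕ) : σ.powImg (n + 1) = compMor σ.img (σ.powImg n) := by
  funext a
  rw [powImg, Function.iterate_succ_apply']; rfl

theorem powImg_succ' (n : ℕ) : σ.powImg (n + 1) = compMor (σ.powImg n) σ.img := by
  induction n with
  | zero => funext a; simp [powImg_succ, powImg_zero, compMor]
  | succ n ih => rw [powImg_succ, ih, ← compMor_assoc, ← powImg_succ, ih]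

theorem nonErasing_powImg (n : ℕ) : NonErasing (σ.powImg n) := by
  induction n with
  | zero => intro a; simp [powImg_zero]
  | succ n ih => rw [powImg_succ]; exact σ.nonErasing_img.comp ih

theorem exists_isRep_onSeq_iterate (n : ℕ) (y : ℤ → A) :
    ∃ c, IsRep (σ.powImg n) (σ.onSeq^[n] y) y c ∧ c 0 = 0 := by
  induction n with
  | zero => exact ⟨id, ⟨fun k => by simp [powImg_zero], fun k => reads_singleton.2 rfl⟩, rfl⟩
  | succ n ih =>
    obtain ⟨c, hc, h0⟩ := ih
    rw [powImg_succ, Function.iterate_succ_apply']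
    exact ⟨_, hc.comp (σ.isRep_onSeq _), by rw [h0, cut_zero]⟩

theorem shift_iterate_apply (i : ℕ) (x : ℤ → A) (k : ℤ) : shift^[i] x k = x (k + i) := by
  induction i generalizing x with
  | zero => simp
  | succ i ih =>
    rw [Function.iterate_succ_apply, ih, shift]
    congr 1; push_cast; ring

/-- The height in the tower becomes the position of a cut: applying `T^i` moves the start of block
`0` from `0` to `-i`. -/
theorem mem_towerLevel_iff {n : ℕ} {a : A} {i : ℕ} {x : ℤ → A} :
    x ∈ towerLevel shift (fun a : A => σ.onSeq^[n] '' σ.cylinder a) a i ↔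
      ∃ y ∈ σ.space, y 0 = a ∧ ∃ c, IsRep (σ.powImg n) x y c ∧ c 0 = -i := by
  constructor
  · rintro ⟨_, ⟨y, ⟨hy, rfl⟩, rfl⟩, rfl⟩
    obtain ⟨c, hc, h0⟩ := σ.exists_isRep_onSeq_iterate n y
    refine ⟨y, hy, rfl, fun k => c k - i, ?_, by simp [h0]⟩
    rw [show shift^[i] (σ.onSeq^[n] y) = fun k => σ.onSeq^[n] y (k + i) from
      funext fun k => shift_iterate_apply i _ k]
    exact hc.translate i
  · rintro ⟨y, hy, rfl, c, hc, h0⟩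
    obtain ⟨d, hd, h0'⟩ := σ.exists_isRep_onSeq_iterate n y
    refine ⟨_, ⟨y, ⟨hy, rfl⟩, rfl⟩, ?_⟩
    have h1 := hd.translate i
    have h2 := h1.cut_eq hc 0 (by simp [h0, h0'])
    rw [h2] at h1
    rw [← h1.seq_eq (σ.nonErasing_powImg n) hc]
    exact funext fun k => shift_iterate_apply i _ k

theorem language_of_infix {v w : List A} (h : v <:+: w) (hw : w ∈ σ.language) :
    v ∈ σ.language := by
  obtain ⟨a, n, hn, hw⟩ := hw
  exact ⟨a, n, hn, h.trans hw⟩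

theorem flatMap_mem_language {w : List A} (hw : w ∈ σ.language) :
    w.flatMap σ.img ∈ σ.language := by
  obtain ⟨a, n, hn, s, t, hw⟩ := hw
  refine ⟨a, n + 1, by omega, s.flatMap σ.img, t.flatMap σ.img, ?_⟩
  rw [powImg_succ, compMor, ← hw, List.flatMap_append, List.flatMap_append]

theorem mem_space_iff {x : ℤ → A} :
    x ∈ σ.space ↔ ∀ p w, Reads x p w → w ∈ σ.language := by
  constructor
  · intro hx p w hw
    refine σ.language_of_infix (hw.infix (reads_ofFn x _ _) ?_ ?_)
      (hx (p.natAbs + w.length))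
    · omega
    · rw [List.length_ofFn]; omega
  · intro h n
    exact h _ _ (reads_ofFn x _ _)

theorem mem_space_of_isRep {x y : ℤ → A} {c : ℤ → ℤ} (hy : y ∈ σ.space)
    (h : IsRep σ.img x y c) : x ∈ σ.space := by
  rw [mem_space_iff] at hy ⊢
  intro p w hw
  have hm := h.strictMono σ.nonErasing_img
  obtain ⟨k, hk, hk'⟩ := hm.exists_int_block p
  obtain ⟨l, hl, hl'⟩ := hm.exists_int_block (p + w.length)
  have hkl : k < l + 1 := hm.lt_iff_lt.1 (by omega)
  have hW := reads_ofFn y k (l + 1 - k).toNat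
  obtain ⟨h1, h2⟩ := h.reads_flatMap hW
  rw [List.length_ofFn, show k + ((l + 1 - k).toNat : ℤ) = l + 1 by omega] at h1
  exact σ.language_of_infix (hw.infix h2 hk (by omega)) (σ.flatMap_mem_language (hy _ _ hW))

theorem exists_approx_preimage [Finite A] : ∃ K : ℕ, (∀ a, (σ.img a).length ≤ K) ∧
    ∀ x ∈ σ.space, ∀ N : ℕ, K ≤ N → ∃ x' y c, IsRep σ.img x' y c ∧ c 0 ≤ 0 ∧ 0 < c 1 ∧
      (∀ k, -(N : ℤ) ≤ k → k ≤ N → x' k = x k) ∧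
      ∀ p w, Reads y p w → -(N : ℤ) ≤ c p → c (p + w.length) ≤ N → w ∈ σ.language := by
  obtain ⟨K, hK⟩ := (Set.finite_range fun a => (σ.img a).length).bddAbove
  have hK' : ∀ a, (σ.img a).length ≤ K := fun a => hK ⟨a, rfl⟩
  refine ⟨K, hK', fun x hx N hN => ?_⟩
  obtain ⟨a, m, hm, hw⟩ := hx N
  obtain ⟨m, rfl⟩ : ∃ m', m = m' + 1 := ⟨m - 1, by omega⟩
  -- The language only admits exponents at least `1`; since `N ≥ K`, the central word, of length `2N
  -- + 1`, is too long to lie in a single `σ a`.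
  have hm0 : 1 ≤ m := by
    by_contra h
    obtain rfl : m = 0 := by omega
    have h1 := hw.length_le
    rw [powImg_succ, powImg_zero, compMor, List.flatMap_singleton, centralWord,
      List.length_ofFn] at h1
    have := hK' a
    omega
  obtain ⟨s, t, hst⟩ := hw
  set w := σ.powImg m a
  -- Outside `w` the letters are arbitrary; only blocks inside the window `[-N, N]` will be used.
  obtain ⟨y, hy⟩ : ∃ y : ℤ → A, Reads y 0 w :=
    ⟨fun k => w[k.toNat]?.getD a, fun j b hj => by simp [hj]⟩
  obtain ⟨x', c, hc, hc0⟩ := exists_isRep σ.nonErasing_img y 0 (-(N : ℤ) - s.length)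
  have hcm := hc.strictMono σ.nonErasing_img
  obtain ⟨h1, h2⟩ := hc.reads_flatMap hy
  have hpow : w.flatMap σ.img = s ++ centralWord x N ++ t := by
    rw [hst, powImg_succ]; rfl
  rw [hpow] at h1 h2
  rw [reads_append, reads_append, hc0, sub_add_cancel] at h2
  have hlen : (centralWord x N).length = 2 * N + 1 := by simp [centralWord]
  simp only [List.length_append, hlen, zero_add] at h1
  push_cast at h1
  obtain ⟨k, hk, hk'⟩ := hcm.exists_int_block 0
  refine ⟨x', _, _, hc.reindex k, by simpa using hk, by simpa [add_comm] using hk', ?_, ?_⟩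
  · intro q hq hq'
    have hj : (centralWord x N)[(q + N).toNat]? = some (x q) := by
      rw [centralWord, List.getElem?_ofFn, dif_pos (by omega)]
      congr 2
      dsimp only
      omega
    have := h2.1.2 _ _ hj
    rwa [show -(N : ℤ) + ((q + N).toNat : ℕ) = q by omega] at this
  · intro p v hv hp hp'
    have hv' : Reads y (p + k) v := fun j b hj => by
      rw [← hv j b hj]; congr 1; ring
    have h3 : 0 ≤ p + k := hcm.le_iff_le.1 (by omega)
    have h4 : p + v.length + k ≤ w.length := hcm.le_iff_le.1 (by omega)
    have h5 : v <:+: w := hv'.infix hy h3 (by omega)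
    exact ⟨a, m, hm0, h5⟩

theorem _root_.Ultrafilter.exists_eventually_eq {ι B : Type*} [Finite B] (U : Ultrafilter ι)
    (f : ι → B) : ∃ b, ∀ᶠ i in U, f i = b := by
  obtain ⟨b, hb⟩ := (U.map f).eq_pure_of_finite
  refine ⟨b, ?_⟩
  have : {b} ∈ U.map f := by rw [hb]; exact Set.mem_singleton b
  exact this

/-- An ultrafilter limit of the approximate preimages: each letter stabilizes because `A` is finite,
and the cuts stabilize because block `0` covers position `0` and so has a bounded offset. -/
theorem exists_preimage [Finite A] {x : ℤ → A} (hx : x ∈ σ.space) :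
    ∃ y ∈ σ.space, ∃ c, IsRep σ.img x y c := by
  obtain ⟨K, hK, H⟩ := σ.exists_approx_preimage
  choose X Y C hC hC0 hC1 hX hY using fun N : ℕ => H x hx (N + K) (Nat.le_add_left K N)
  let U : Ultrafilter ℕ := Filter.hyperfilter ℕ
  have hU : ∀ n : ℕ, ∀ᶠ N in (U : Filter ℕ), n ≤ N := fun n =>
    (Nat.hyperfilter_le_atTop : (U : Filter ℕ) ≤ _) (Filter.eventually_ge_atTop n)
  choose y hy using fun k => U.exists_eventually_eq fun N => Y N k
  obtain ⟨i, hi⟩ := U.exists_eventually_eq fun N => (⟨(-C N 0).toNat, by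
    have h1 := hC0 N
    have h2 := hC1 N
    have h3 := (hC N).step 0
    rw [zero_add] at h3
    have := hK (Y N 0)
    omega⟩ : Fin (K + 1))
  obtain ⟨c, hc0, hc⟩ := exists_partial_sum (fun k => ((σ.img (y k)).length : ℤ)) (-(i : ℕ))
  have hCc : ∀ k, ∀ᶠ N in (U : Filter ℕ), C N k = c k := by
    intro k
    refine Int.inductionOn' (motive := fun k => ∀ᶠ N in (U : Filter ℕ), C N k = c k) k 0
      ?_ (fun k _ ih => ?_) fun k _ ih => ?_
    · filter_upwards [hi] with N hN
      have h1 := hC0 N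
      have h2 := congrArg Fin.val hN
      dsimp only at h2
      rw [hc0]; omega
    · filter_upwards [ih, hy k] with N h1 h2
      rw [(hC N).step, hc, h1, h2]
    · filter_upwards [ih, hy (k - 1)] with N h1 h2
      have h3 := (hC N).step (k - 1)
      have h4 := hc (k - 1)
      rw [sub_add_cancel] at h3 h4
      rw [h2] at h3
      omega
  refine ⟨y, σ.mem_space_iff.2 fun p w hw => ?_, c, hc, fun k j b hj => ?_⟩
  · have hr : ∀ᶠ N in (U : Filter ℕ), Reads (Y N) p w := by
      have : ∀ᶠ N in (U : Filter ℕ), ∀ j ∈ Finset.range w.length, Y N (p + j) = y (p + j) :=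
        (Filter.eventually_all_finset _).2 fun j _ => hy _
      filter_upwards [this] with N hN j b hj
      rw [hN j (Finset.mem_range.2 (List.getElem?_eq_some_iff.1 hj).1)]
      exact hw j b hj
    obtain ⟨N, h1, h2, h3, h4⟩ := (hr.and ((hCc p).and ((hCc (p + w.length)).and
      (hU ((c p).natAbs + (c (p + w.length)).natAbs))))).exists
    exact hY N p w h1 (by rw [h2]; omega) (by rw [h3]; omega)
  · obtain ⟨N, h1, h2, h3⟩ := ((hCc k).and ((hy k).and (hU (c k + j).natAbs))).exists
    rw [← hX N (c k + j) (by omega) (by omega), ← h1]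
    exact (hC N).reads k j b (by rw [h2, hj])

theorem isSubstitutive_img [Finite A] (hσ : σ.Aperiodic) : IsSubstitutive σ.img σ.space where
  image := σ.mem_space_of_isRep
  preimage := σ.exists_preimage
  aperiodic := by
    intro x hx p hp h
    refine hσ x hx ⟨p.toNat, by omega, funext fun k => ?_⟩
    rw [shift_iterate_apply, ← h k]; congr 1; omega

theorem isSubstitutive_powImg [Finite A] (hσ : σ.Aperiodic) (n : ℕ) :
    IsSubstitutive (σ.powImg n) σ.space := by
  have H := σ.isSubstitutive_img hσ
  induction n with
  | zero =>
    have key : ∀ {x y : ℤ → A} {c}, IsRep (σ.powImg 0) x y c → ∀ k, x (k + c 0) = y k := by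
      intro x y c h k
      have := (h.translate (c 0)).of_singletons (f := id) (by simp) k
      exact this
    refine ⟨fun {x y c} hy h => ?_, fun {x} hx => ⟨x, hx, ?_⟩, H.aperiodic⟩
    · rw [mem_space_iff] at hy ⊢
      intro p w hw
      refine hy (p - c 0) w fun j b hj => ?_
      rw [← key h, ← hw j b hj]; congr 1; ring
    · obtain ⟨c, hc, -⟩ := σ.exists_isRep_onSeq_iterate 0 x
      exact ⟨c, hc⟩
  | succ n ih => rw [powImg_succ]; exact H.comp σ.nonErasing_img (σ.nonErasing_powImg n) ih

/-! ### Clopen levels and the partition -/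

section Topology

variable [TopologicalSpace A]

theorem continuous_shift : Continuous (shift : (ℤ → A) → ℤ → A) :=
  continuous_pi fun k => continuous_apply (k + 1)

variable [DiscreteTopology A]

theorem continuous_onSeq : Continuous σ.onSeq := by
  refine continuous_pi fun m => (IsLocallyConstant.iff_eventually_eq _).2 (fun y => ?_) |>.continuous
  have hk := σ.block_spec y m
  have hl := σ.block_lt y m
  set k := σ.block y m
  obtain ⟨j, hj⟩ : ∃ j : ℕ, m = σ.cut y k + j := ⟨(m - σ.cut y k).toNat, by omega⟩
  have hjl : j < (σ.img (y k)).length := by omega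
  -- These finitely many letters determine both the position of block `k` and its word, hence the
  -- letter at `m`.
  have hev : ∀ᶠ y' in nhds y, ∀ i ∈ insert k (Finset.Ico 0 k ∪ Finset.Ico k 0), y' i = y i := by
    refine (Filter.eventually_all_finset _).2 fun i _ => ?_
    have ho : IsOpen ((fun f : ℤ → A => f i) ⁻¹' {y i}) :=
      (isOpen_discrete {y i}).preimage (continuous_apply i)
    filter_upwards [ho.mem_nhds rfl] with y' h using h
  filter_upwards [hev] with y' hy'
  have hcut : σ.cut y' k = σ.cut y k := by
    unfold cut
    congr 1 <;> refine Finset.sum_congr rfl fun i hi => ?_ <;> rw [hy' i (by simp at hi ⊢; omega)]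
  have hyk : y' k = y k := hy' k (by simp)
  have h1 := (σ.isRep_onSeq y').reads k j _ (by
    rw [hyk]; exact List.getElem?_eq_getElem hjl)
  have h2 := (σ.isRep_onSeq y).reads k j _ (List.getElem?_eq_getElem hjl)
  rw [hcut, ← hj] at h1
  rw [← hj] at h2
  rw [h1, h2]

theorem isClosed_space : IsClosed σ.space := by
  rw [show σ.space = ⋂ n, {x | centralWord x n ∈ σ.language} by ext; simp [space]]
  refine isClosed_iInter fun n => ?_
  have hc : Continuous fun (x : ℤ → A) (i : Fin (2 * n + 1)) => x (-(n : ℤ) + (i : ℕ)) :=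
    continuous_pi fun i => continuous_apply _
  exact (isClosed_discrete {f : Fin (2 * n + 1) → A | List.ofFn f ∈ σ.language}).preimage hc

theorem isClosed_towerLevel [Finite A] (n : ℕ) (a : A) (i : ℕ) :
    IsClosed (towerLevel shift (fun a : A => σ.onSeq^[n] '' σ.cylinder a) a i) := by
  have h0 : IsClosed ((fun x : ℤ → A => x 0) ⁻¹' {a}) :=
    (isClosed_discrete {a}).preimage (continuous_apply 0)
  have hcl : IsClosed (σ.cylinder a) := σ.isClosed_space.inter h0
  exact ((hcl.isCompact.image (σ.continuous_onSeq.iterate n)).image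
    (continuous_shift.iterate i)).isClosed

theorem isKRPartition [Finite A] (hσ : σ.Aperiodic) (n : ℕ) :
    IsKRPartition σ.space shift
      (fun a : A => σ.onSeq^[n] '' σ.cylinder a) (fun a : A => (σ.powImg n a).length) := by
  have H := σ.isSubstitutive_powImg hσ n
  have hne := σ.nonErasing_powImg n
  have hdisj : ∀ v, ∀ i < (σ.powImg n v).length, ∀ w, ∀ j < (σ.powImg n w).length,
      (v, i) ≠ (w, j) →
      Disjoint (towerLevel shift (fun a : A => σ.onSeq^[n] '' σ.cylinder a) v i)
        (towerLevel shift (fun a : A => σ.onSeq^[n] '' σ.cylinder a) w j) := by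
    intro v i hi w j hj hne'
    rw [Set.disjoint_left]
    intro x hx hx'
    obtain ⟨y, hy, rfl, c, hc, hc0⟩ := σ.mem_towerLevel_iff.1 hx
    obtain ⟨z, hz, rfl, d, hd, hd0⟩ := σ.mem_towerLevel_iff.1 hx'
    obtain ⟨m, hm⟩ := H.exists_eq_reindex hne hy hz hc hd
    have h1 := hc.step 0
    have h2 := hd.step 0
    have h3 := (hm 0).2
    have h4 := (hm 1).2
    rw [zero_add] at h1 h2 h3
    -- Block `0` covers position `0` in both representations, which leaves no room for a reindexing.
    have : m = 0 := (hd.strictMono hne).int_block_unique (m := 0) (by omega)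
      (by rw [add_comm]; omega) (by omega) (by rw [zero_add]; omega)
    subst this
    refine hne' (Prod.ext ?_ ?_)
    · have := (hm 0).1
      rw [add_zero] at this
      exact this.symm
    · dsimp only; omega
  have hcover : ∀ x ∈ σ.space, ∃ v, ∃ i < (σ.powImg n v).length,
      x ∈ towerLevel shift (fun a : A => σ.onSeq^[n] '' σ.cylinder a) v i := by
    intro x hx
    obtain ⟨y, hy, c, hc⟩ := H.preimage hx
    obtain ⟨k, hk, hk'⟩ := (hc.strictMono hne).exists_int_block 0
    rw [hc.step] at hk'
    refine ⟨y k, (-c k).toNat, by omega, σ.mem_towerLevel_iff.2 ⟨fun l => y (l + k), ?_, by simp,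
      _, hc.reindex k, by rw [zero_add]; omega⟩⟩
    rw [mem_space_iff] at hy ⊢
    intro p w hw
    refine hy (p + k) w fun j b hj => ?_
    rw [← hw j b hj]; congr 1; ring
  have hsub : ∀ v i, towerLevel shift (fun a : A => σ.onSeq^[n] '' σ.cylinder a) v i ⊆ σ.space := by
    intro v i x hx
    obtain ⟨y, hy, -, c, hc, -⟩ := σ.mem_towerLevel_iff.1 hx
    exact H.image hy hc
  refine ⟨inferInstance, fun v => List.length_pos_iff.2 (hne v), fun v i _ => hsub v i, ?_, hdisj,
    fun x hx => ?_⟩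
  · intro v i hi
    refine ⟨(σ.isClosed_towerLevel n v i).preimage continuous_subtype_val, ?_⟩
    have hfin : Set.Finite {q : A × ℕ | q.2 < (σ.powImg n q.1).length ∧ q ≠ (v, i)} := by
      refine (Set.finite_iUnion fun a : A => (Set.finite_Iio (σ.powImg n a).length).image
        (Prod.mk a)).subset ?_
      rintro ⟨a, j⟩ ⟨hj, -⟩
      exact Set.mem_iUnion.2 ⟨a, j, hj, rfl⟩
    -- The complement of a level in `X_σ` is the finite union of the other levels, all closed.
    rw [← isClosed_compl_iff]
    convert hfin.isClosed_biUnion fun q _ =>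
      (σ.isClosed_towerLevel n q.1 q.2).preimage (continuous_subtype_val (p := (· ∈ σ.space)))
    ext ⟨x, hx⟩
    simp only [Set.mem_compl_iff, Set.mem_preimage, Set.mem_iUnion, Set.mem_ofPred_eq, exists_prop]
    constructor
    · intro h
      obtain ⟨w, j, hj, hxw⟩ := hcover x hx
      refine ⟨(w, j), ⟨hj, ?_⟩, hxw⟩
      rintro ⟨⟩
      exact h hxw
    · rintro ⟨⟨w, j⟩, ⟨hj, hq⟩, hxw⟩ h
      exact Set.disjoint_left.1 (hdisj w j hj v i hi hq) hxw h
  · obtain ⟨v, i, hi, h⟩ := hcover x hx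
    simp only [Set.mem_iUnion]
    exact ⟨v, i, hi, h⟩

end Topology

/-! ### Nestedness -/

theorem isKRNested (n : ℕ) : IsKRNested shift
    (fun a : A => σ.onSeq^[n + 1] '' σ.cylinder a) (fun a : A => (σ.powImg (n + 1) a).length)
    (fun a : A => σ.onSeq^[n] '' σ.cylinder a) (fun a : A => (σ.powImg n a).length) where
  refines a i hi := by
    rw [powImg_succ'] at hi
    obtain ⟨w, b, w', hw, j, rfl, hj⟩ := exists_split_of_lt_length_flatMap _ hi
    refine ⟨b, j, hj, fun x hx => ?_⟩
    obtain ⟨y, hy, rfl, c, hc, hc0⟩ := σ.mem_towerLevel_iff.1 hx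
    -- Starting `σ a = w b w'` at `-|w|` puts `b` at index `0`, so that the `σ^n`-block covering
    -- position `0` of `x` is that of `u 0`.
    obtain ⟨u, d, hu, hd0⟩ := exists_isRep σ.nonErasing_img y 0 (-(w.length : ℤ))
    rw [powImg_succ'] at hc
    obtain ⟨f, hf, hfd⟩ := hc.decomp (σ.nonErasing_powImg n)
      ((σ.nonErasing_powImg n).comp σ.nonErasing_img) hu
    have hr := hu.reads 0
    rw [hw, hd0, reads_append, reads_cons, neg_add_cancel] at hr
    refine σ.mem_towerLevel_iff.2 ⟨u, σ.mem_space_of_isRep hy hu, hr.2.1, f, hf, ?_⟩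
    have h1 := (hf.reads_flatMap hr.1).1
    have h2 := hfd 0
    rw [hd0] at h2
    rw [neg_add_cancel, h2, hc0] at h1
    rw [h1]; push_cast; ring
  base_subset := by
    intro x hx
    simp only [Set.mem_iUnion] at hx ⊢
    obtain ⟨a, y, ⟨hy, -⟩, rfl⟩ := hx
    exact ⟨σ.onSeq y 0, σ.onSeq y, ⟨σ.mem_space_of_isRep hy (σ.isRep_onSeq y), rfl⟩,
      (Function.iterate_succ_apply _ _ _).symm⟩

end Substitution

theorem mainTheorem10 {A : Type*} [Finite A] [TopologicalSpace A] [DiscreteTopology A]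
    (σ : Substitution A) (hσ : σ.Aperiodic) :
    (∀ n : ℕ, IsKRPartition σ.space Substitution.shift
      (fun a : A => σ.onSeq^[n] '' σ.cylinder a) (fun a : A => (σ.powImg n a).length)) ∧
    (∀ n : ℕ, IsKRNested Substitution.shift
      (fun a : A => σ.onSeq^[n + 1] '' σ.cylinder a) (fun a : A => (σ.powImg (n + 1) a).length)
      (fun a : A => σ.onSeq^[n] '' σ.cylinder a) (fun a : A => (σ.powImg n a).length)) :=
  ⟨σ.isKRPartition hσ, σ.isKRNested⟩
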